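/- Permutations are finite; $\sigma$ is contained in $\pi$ if $\pi$ has a subsequence order isomorphic to $\sigma$, a permutation class is a set of permutations closed downward under containment, $\operatorname{Av}(\beta)$ is the class of permutations not containing $\beta$, and $\operatorname{Sub}(\pi)$ is the class of permutations contained in $\pi$. For $\sigma$ of length $m$, the inflation $\sigma[\alpha_1,\dots,\alpha_m]$ by nonempty permutations is obtained by replacing each entry $\sigma(i)$ by an interval order isomorphic to $\alpha_i$; it is proper if some $\alpha_i$ has length at least $2$. A permutation is simple if its only intervals (sets of contiguous positions whose values are contiguous) have length $0$, $1$ or the full length. Let $\bigoplus\mathcal{C}$ and $\bigominus\mathcal{C}$ be the smallest classes containing $\mathcal{C}$ that are closed under the sum $\pi\oplus\sigma=12[\pi,\sigma]$, respectively the skew sum $\pi\ominus\sigma=21[\pi,\sigma]$, and let $\langle\mathcal{C}\rangle$ be the smallest class containing $\mathcal{C}$ that is closed under inflation. Write $\mathrm{gr}(\mathcal{C})=\lim_{n\to\infty}|\mathcal{C}_n|^{1/n}$, where $\mathcal{C}_n$ is the set of members of $\mathcal{C}$ of length $n$ (this limit exists, possibly infinite, for sum closed and for skew closed classes), and for real $\gamma$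 let \[ \mathcal{G}_\gamma=\{\pi : \mathrm{gr}(\textstyle\bigoplus\operatorname{Sub}(\pi))<\gamma\ \text{ or }\ \mathrm{gr}(\textstyle\bigominus\operatorname{Sub}(\pi))<\gamma\}. \] Proposition. (1) Every simple permutation in $\mathcal{G}_{2.36}$ lies in $\operatorname{Av}(321)\cup\operatorname{Av}(123)\cup\{25314, 41352\}$. (2) No proper inflation of $25314$ or of $41352$ lies in $\mathcal{G}_{2.36}$. (3) $\mathcal{G}_{2.36}\subseteq\langle\operatorname{Av}(321)\cup\operatorname{Av}(123)\cup\{25314, 41352\}\rangle$. -/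

import Mathlib

namespace PermClass

open Filter
open scoped ENNReal

/-- A finite permutation, of any length `n` (its first component); entries and positions are
indexed by `0, …, n - 1`. -/
abbrev FinPerm : Type := Σ n : ℕ, Equiv.Perm (Fin n)

/-- The permutation with one-line notation `12`. -/
abbrev perm12 : FinPerm := ⟨2, ⟨![0, 1], ![0, 1], by decide, by decide⟩⟩

/-- The permutation with one-line notation `21`. -/
abbrev perm21 : FinPerm := ⟨2, ⟨![1, 0], ![1, 0], by decide, by decide⟩⟩

/-- The permutation with one-line notation `123`. -/
abbrev perm123 : FinPerm := ⟨3, ⟨![0, 1, 2], ![0, 1, 2], by decide, by decide⟩⟩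

/-- The permutation with one-line notation `321`. -/
abbrev perm321 : FinPerm := ⟨3, ⟨![2, 1, 0], ![2, 1, 0], by decide, by decide⟩⟩

/-- The permutation with one-line notation `25314` (its inverse is `41352`). -/
abbrev perm25314 : FinPerm := ⟨5, ⟨![1, 4, 2, 0, 3], ![3, 0, 2, 4, 1], by decide, by decide⟩⟩

/-- The permutation with one-line notation `41352` (its inverse is `25314`). -/
abbrev perm41352 : FinPerm := ⟨5, ⟨![3, 0, 2, 4, 1], ![1, 4, 2, 0, 3], by decide, by decide⟩⟩

/-- `σ` is contained in `π`: some subsequence of `π` is order isomorphic to `σ`. -/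
def Contained (σ π : FinPerm) : Prop :=
  ∃ f : Fin σ.1 → Fin π.1, StrictMono f ∧ ∀ i j, σ.2 i < σ.2 j ↔ π.2 (f i) < π.2 (f j)

/-- A permutation class: a set of permutations closed downward under containment. -/
def IsPermClass (C : Set FinPerm) : Prop :=
  ∀ σ π : FinPerm, Contained σ π → π ∈ C → σ ∈ C

/-- `Av(B)`, the permutations that avoid every member of `B`. -/
def Av (B : Set FinPerm) : Set FinPerm :=
  {π | ∀ β ∈ B, ¬ Contained β π}

/-- `Sub(π)`, the permutations contained in `π`. -/
def Sub (π : FinPerm) : Set FinPerm :=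
  {σ | Contained σ π}

/-- `IsInflation τ σ α` says that `τ` is the inflation `σ[α₁, …, αₘ]`, i.e. that `τ` is obtained
from `σ` by replacing the `i`-th entry by an interval order isomorphic to `α i`.
Here `e ⟨i, a⟩` is the position in `τ` of the `a`-th entry of the `i`-th block. -/
def IsInflation (τ σ : FinPerm) (α : Fin σ.1 → FinPerm) : Prop :=
  ∃ e : (Σ i : Fin σ.1, Fin (α i).1) ≃ Fin τ.1,
    (∀ i j a b, i ≠ j → (e ⟨i, a⟩ < e ⟨j, b⟩ ↔ i < j)) ∧
    (∀ i a b, e ⟨i, a⟩ < e ⟨i, b⟩ ↔ a < b) ∧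
    (∀ i j a b, i ≠ j → (τ.2 (e ⟨i, a⟩) < τ.2 (e ⟨j, b⟩) ↔ σ.2 i < σ.2 j)) ∧
    (∀ i a b, τ.2 (e ⟨i, a⟩) < τ.2 (e ⟨i, b⟩) ↔ (α i).2 a < (α i).2 b)

/-- `τ` is an inflation of `σ` by nonempty permutations, not all of which have length `1`. -/
def IsProperInflation (τ σ : FinPerm) : Prop :=
  ∃ α : Fin σ.1 → FinPerm, (∀ i, 1 ≤ (α i).1) ∧ (∃ i, 2 ≤ (α i).1) ∧ IsInflation τ σ α

/-- `τ = π ⊕ σ = 12[π, σ]`. -/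
def IsSum (τ π σ : FinPerm) : Prop := IsInflation τ perm12 ![π, σ]

/-- `τ = π ⊖ σ = 21[π, σ]`. -/
def IsSkewSum (τ π σ : FinPerm) : Prop := IsInflation τ perm21 ![π, σ]

def SumClosed (C : Set FinPerm) : Prop :=
  ∀ π ∈ C, ∀ σ ∈ C, ∀ τ, IsSum τ π σ → τ ∈ C

def SkewClosed (C : Set FinPerm) : Prop :=
  ∀ π ∈ C, ∀ σ ∈ C, ∀ τ, IsSkewSum τ π σ → τ ∈ C

def SubstitutionClosed (C : Set FinPerm) : Prop :=
  ∀ σ ∈ C, ∀ α : Fin σ.1 → FinPerm, (∀ i, α i ∈ C ∧ 1 ≤ (α i).1) →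
    ∀ τ, IsInflation τ σ α → τ ∈ C

/-- The smallest sum closed permutation class containing `C`. -/
def sumClosure (C : Set FinPerm) : Set FinPerm :=
  ⋂₀ {D | IsPermClass D ∧ SumClosed D ∧ C ⊆ D}

/-- The smallest skew closed permutation class containing `C`. -/
def skewClosure (C : Set FinPerm) : Set FinPerm :=
  ⋂₀ {D | IsPermClass D ∧ SkewClosed D ∧ C ⊆ D}

/-- The smallest substitution closed permutation class containing `C`. -/
def substitutionClosure (C : Set FinPerm) : Set FinPerm :=
  ⋂₀ {D | IsPermClass D ∧ SubstitutionClosed D ∧ C ⊆ D}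

/-- The set `I` of positions is an interval of `π`: both `I` and its image are contiguous. -/
def IsInterval (π : FinPerm) (I : Set (Fin π.1)) : Prop :=
  I.OrdConnected ∧ (π.2 '' I).OrdConnected

/-- `π` is simple: its only intervals have length `0`, `1` or the length of `π`. -/
def IsSimple (π : FinPerm) : Prop :=
  ∀ I : Set (Fin π.1), IsInterval π I → I.Subsingleton ∨ I = Set.univ

/-- The number of permutations of length `n` in `C`. -/
noncomputable def speed (C : Set FinPerm) (n : ℕ) : ℕ :=
  Set.ncard {p : Equiv.Perm (Fin n) | (⟨n, p⟩ : FinPerm) ∈ C}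

noncomputable def upperGrowthRate (C : Set FinPerm) : ℝ≥0∞ :=
  limsup (fun n : ℕ => (speed C n : ℝ≥0∞) ^ (1 / (n : ℝ))) atTop

noncomputable def lowerGrowthRate (C : Set FinPerm) : ℝ≥0∞ :=
  liminf (fun n : ℕ => (speed C n : ℝ≥0∞) ^ (1 / (n : ℝ))) atTop

/-- `C` has the growth rate `g`: its upper and lower growth rates are both equal to `g`. -/
def HasGrowthRate (C : Set FinPerm) (g : ℝ≥0∞) : Prop :=
  upperGrowthRate C = g ∧ lowerGrowthRate C = g

/-- The cell class `𝒢_γ`: the permutations `π` such that the sum closure or the skew closure of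
`Sub(π)` has growth rate less than `γ`. -/
def cellClass (γ : ℝ) : Set FinPerm :=
  {π | (∃ g, HasGrowthRate (sumClosure (Sub π)) g ∧ g < ENNReal.ofReal γ) ∨
       (∃ g, HasGrowthRate (skewClosure (Sub π)) g ∧ g < ENNReal.ofReal γ)}

end PermClass

namespace PermClass

open Filter
open scoped ENNReal

/-! The growth bound is turned into a condition on finitely many patterns. A sum has a unique first
sum indecomposable component, so if a sum closed class contains a finite set `X` of nonempty sum
indecomposables, its counting sequence satisfies s(n) ≥ ∑ s(n - |q|) over q in `X`. If moreover ∑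
γ^(-|q|) ≥ 1, then s(n) is at least a constant times γ^n (`pow_le_mul_speed`). Hence gr(⊕Sub(π)) <
2.36 implies `LowGrowth π`: no pattern of π has enough sum indecomposable patterns to reach this
threshold. Reversal carries skew sums to sums, so every member of the cell class is of low growth or
has a reverse of low growth.

Let π be simple, of low growth, and contain 321. A proper block of an occurrence cannot be an
interval of π, so some entry of π cuts it. A finite search (`blockTable_splits`) shows that,
starting from 321, every such cut forces growth, creates 25314 or 41352, or leads to another listed
pattern with a block. The occurrence gains an entry at each cut, so one of 25314 and 41352 must
appear.

These two patterns are rigid: in a low growth permutation every further entry lies below and to the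
left, or above and to the right, of the whole occurrence (`LowGrowth.corner_of_isRigid`). The
occurrence is therefore an interval, so a simple π equals it. A proper inflation would put a further
entry inside a block, which is not such a corner.

Finally, a non-simple permutation is an inflation of shorter permutations that it contains. Low
growth passes to contained permutations, so induction on the length gives the inclusion in the
substitution closure. -/

/-! ### Finite computations with words -/

/-- `k l`, computed after the letters of `l` have been evaluated. -/
def withLetters {β : Type} : List ℕ → (List ℕ → β) → β
  | [], k => k []
  | .zero :: l, k => withLetters l fun l' => k (.zero :: l')
  | .succ a :: l, k => withLetters l fun l' => k (.succ a :: l')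

/-- The word obtained from `l` by replacing its `i`-th smallest letter by `i`. -/
def standardize (l : List ℕ) : List ℕ := l.map fun x => l.countP fun y => Nat.blt y x

/-- No proper nonempty prefix of `l` of length `k` has all its letters below `k`. -/
def sumIndecomposable (l : List ℕ) : Bool :=
  (List.range l.length).all fun k => Nat.beq k 0 || (l.take k).any fun x => Nat.ble k x

/-- Equality of words. -/
def sameWord : List ℕ → List ℕ → Bool
  | [], [] => true
  | a :: l, b :: m => Nat.beq a b && sameWord l m
  | [], _ :: _ => false
  | _ :: _, [] => false

/-- Adds `q` to the list `R` if it is nonempty, sum indecomposable and not in `R`. -/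
def addIndecomposable (q : List ℕ) (R : List (List ℕ)) : List (List ℕ) :=
  if !q.isEmpty && (sumIndecomposable q && !R.any (sameWord q)) then q :: R else R

/-- The distinct nonempty sum indecomposable patterns of the word `l`. -/
def sumIndecomposables (l : List ℕ) : List (List ℕ) :=
  l.sublists.foldl (fun R q => withLetters (standardize q) fun q' => addIndecomposable q' R) []

/-- `l` has enough sum indecomposable patterns to force the growth rate `2.36 = 59 / 25`. -/
def forcesGrowth (l : List ℕ) : Bool :=
  -- The one-letter word keeps the counting sequence positive, which starts the growth induction.
  -- The inequality is ∑ (25/59)^|q| ≥ 1, cleared of denominators.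
  (sumIndecomposables l).any (sameWord [0]) &&
    Nat.ble (59 ^ l.length)
      ((sumIndecomposables l).map fun q => 25 ^ q.length * 59 ^ (l.length - q.length)).sum

/-- The word `l₁ l₂` with a new letter `v` between the two parts; the old letters that are at
least `v` are raised by one. -/
def insertLetter (l₁ l₂ : List ℕ) (v : ℕ) : List ℕ :=
  l₁.map (fun w => bif Nat.blt w v then w else w + 1) ++
    v :: l₂.map (fun w => bif Nat.blt w v then w else w + 1)

/-- The two words both have a letter in `S`. -/
def splitsPositions (S l₁ l₂ : List ℕ) : Bool :=
  l₁.any (S.contains ·) && l₂.any (S.contains ·)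

/-- Letters of `l` in `S` lie on both sides of the value `v`. -/
def splitsValues (S l : List ℕ) (v : ℕ) : Bool :=
  l.any (fun w => S.contains w && Nat.blt w v) && l.any (fun w => S.contains w && Nat.ble v w)

/-- The letters in `S` form a proper interval with at least two entries in the word `l`. -/
def isProperBlock (S l : List ℕ) : Bool :=
  Nat.ble 2 (l.countP (S.contains ·)) && l.any (fun w => !S.contains w) &&
    (List.range l.length).all fun t =>
      match l.drop t with
      | [] => true
      | m :: _ => S.contains m ||
          (!splitsPositions S (l.take t) (l.drop t) && !splitsValues S l m)

/-- `l` has `25314` or `41352` as a pattern. -/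
def hasExceptional (l : List ℕ) : Bool :=
  l.sublists.any fun q => Nat.beq q.length 5 &&
    (standardize q == [1, 4, 2, 0, 3] || standardize q == [3, 0, 2, 4, 1])

/-- Patterns containing `321`, each with a proper block that has to be split in a simple
permutation. -/
def blockTable : List (List ℕ × List ℕ) :=
  [([2, 1, 0], [2, 1]),
   ([2, 3, 1, 0], [2, 3]),
   ([3, 0, 2, 1], [2, 1]),
   ([3, 1, 0, 2], [1, 0]),
   ([3, 1, 2, 0], [1, 2]),
   ([2, 4, 1, 0, 3], [1, 0]),
   ([2, 4, 3, 1, 0], [4, 3]),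
   ([3, 0, 4, 2, 1], [2, 1]),
   ([3, 2, 4, 1, 0], [3, 2]),
   ([4, 0, 2, 3, 1], [2, 3]),
   ([4, 0, 3, 1, 2], [1, 2]),
   ([4, 1, 2, 0, 3], [1, 2]),
   ([4, 1, 3, 2, 0], [3, 2]),
   ([4, 2, 0, 1, 3], [0, 1]),
   ([4, 2, 1, 3, 0], [2, 1]),
   ([2, 4, 5, 3, 1, 0], [4, 5]),
   ([3, 4, 2, 5, 1, 0], [3, 4]),
   ([5, 0, 4, 1, 3, 2], [3, 2]),
   ([5, 0, 4, 2, 1, 3], [2, 1]),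
   ([5, 3, 0, 2, 1, 4], [2, 1]),
   ([5, 3, 1, 0, 2, 4], [1, 0])]

/-- Every way to split the block `S` of `l` by a new letter yields a word that forces growth, has
an exceptional pattern or is listed in `T`. -/
def splitsIntoTable (T : List (List ℕ × List ℕ)) (l S : List ℕ) : Bool :=
  isProperBlock S l &&
    (List.range (l.length + 1)).all fun t => (0 :: l.map (· + 1)).all fun v =>
      -- A letter that splits both the positions and the values lies inside the hull of the block
      -- and does not cut it; hence the exclusive or.
      !(splitsPositions S (l.take t) (l.drop t) ^^ splitsValues S l v) ||
        (T.any (fun e => e.1 == insertLetter (l.take t) (l.drop t) v) ||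
          (hasExceptional (insertLetter (l.take t) (l.drop t) v) ||
            forcesGrowth (insertLetter (l.take t) (l.drop t) v)))

/-- The search is closed: a cut never leaves the table except towards forced growth or an
exceptional pattern. -/
theorem blockTable_splits : (blockTable.all fun e => splitsIntoTable blockTable e.1 e.2) = true := by
  decide +kernel

/-- All one-letter extensions of `l`, except by a new minimum at the start or a new maximum at the
end, force growth. -/
def isRigid (l : List ℕ) : Bool :=
  (List.range (l.length + 1)).all fun t => (0 :: l.map (· + 1)).all fun v =>
    -- Growth cannot exclude these two corners: adding a sum component of length one to a nonempty
    -- pattern creates no new sum indecomposable pattern.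
    (Nat.beq t 0 && Nat.beq v 0) || (Nat.beq t l.length && Nat.beq v l.length) ||
      forcesGrowth (insertLetter (l.take t) (l.drop t) v)

theorem isRigid_25314 : isRigid [1, 4, 2, 0, 3] = true := by decide +kernel

theorem isRigid_41352 : isRigid [3, 0, 2, 4, 1] = true := by decide +kernel

/-! ### Labelled occurrences and standardization -/

/-- The one-line notation of `π`. -/
def oneLine (π : FinPerm) : List ℕ := List.ofFn fun i => (π.2 i : ℕ)

/-- The list `M` of positions of `π` with labels is increasing in the positions, and the labels are
ordered like the entries of `π` at these positions. -/
def Occurrence (π : FinPerm) (M : List (Fin π.1 × ℕ)) : Prop :=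
  M.Pairwise fun a b => a.1 < b.1 ∧
    (a.2 < b.2 ↔ π.2 a.1 < π.2 b.1) ∧ (b.2 < a.2 ↔ π.2 b.1 < π.2 a.1)

namespace Occurrence

variable {π : FinPerm} {M : List (Fin π.1 × ℕ)}

theorem sublist {M' : List (Fin π.1 × ℕ)} (h : Occurrence π M) (hM : M'.Sublist M) :
    Occurrence π M' :=
  List.Pairwise.sublist hM h

theorem label_lt_iff (h : Occurrence π M) {a b : Fin π.1 × ℕ} (ha : a ∈ M) (hb : b ∈ M) :
    a.2 < b.2 ↔ π.2 a.1 < π.2 b.1 := by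
  have key : ∀ ⦃a⦄, a ∈ M → ∀ ⦃b⦄, b ∈ M →
      ((a.2 < b.2 ↔ π.2 a.1 < π.2 b.1) ∧ (b.2 < a.2 ↔ π.2 b.1 < π.2 a.1)) := by
    intro a ha b hb
    by_cases hab : a = b
    · subst hab; simp
    have : Std.Symm fun a b : Fin π.1 × ℕ =>
        (a.2 < b.2 ↔ π.2 a.1 < π.2 b.1) ∧ (b.2 < a.2 ↔ π.2 b.1 < π.2 a.1) :=
      ⟨fun _ _ h => ⟨h.2, h.1⟩⟩
    exact List.Pairwise.forall (List.Pairwise.imp (fun h => h.2) h) ha hb hab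
  exact (key ha hb).1

theorem nodup_positions (h : Occurrence π M) : (M.map Prod.fst).Nodup := by
  rw [List.Nodup, List.pairwise_map]
  exact List.Pairwise.imp (fun h => h.1.ne) h

theorem length_le (h : Occurrence π M) : M.length ≤ π.1 := by
  have := h.nodup_positions.length_le_card
  simpa using this

theorem relabel (h : Occurrence π M) (g : ℕ → ℕ)
    (hg : ∀ a ∈ M.map Prod.snd, ∀ b ∈ M.map Prod.snd, g a < g b ↔ a < b) :
    Occurrence π (M.map fun a => (a.1, g a.2)) := by
  rw [Occurrence, List.pairwise_map]
  refine List.Pairwise.imp_of_mem (fun {a b} ha hb hab => ?_) h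
  have ha' := List.mem_map_of_mem (f := Prod.snd) ha
  have hb' := List.mem_map_of_mem (f := Prod.snd) hb
  exact ⟨hab.1, (hg _ ha' _ hb').trans hab.2.1, (hg _ hb' _ ha').trans hab.2.2⟩

end Occurrence

theorem countP_lt_countP {p q : ℕ → Bool} {l : List ℕ} (hpq : ∀ x ∈ l, p x → q x)
    (h : ∃ x ∈ l, q x = true ∧ p x = false) : l.countP p < l.countP q := by
  obtain ⟨x, hx, hqx, hpx⟩ := h
  obtain ⟨s, t, rfl⟩ := List.append_of_mem hx
  have h1 : s.countP p ≤ s.countP q := List.countP_mono_left fun y hy => hpq y (by simp [hy])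
  have h2 : t.countP p ≤ t.countP q := List.countP_mono_left fun y hy => hpq y (by simp [hy])
  simp only [List.countP_append, List.countP_cons, hqx, hpx]
  simp
  omega

theorem rank_lt_rank {l : List ℕ} {a b : ℕ} (ha : a ∈ l) (hab : a < b) :
    (l.countP fun y => Nat.blt y a) < l.countP fun y => Nat.blt y b := by
  refine countP_lt_countP (fun x _ hx => ?_) ⟨a, ha, ?_, ?_⟩
  · rw [Nat.blt_eq] at *; omega
  · rw [Nat.blt_eq]; exact hab
  · rw [← Bool.not_eq_true, Nat.blt_eq]; omega

theorem rank_lt_rank_iff {l : List ℕ} {a b : ℕ} (ha : a ∈ l) (hb : b ∈ l) :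
    ((l.countP fun y => Nat.blt y a) < l.countP fun y => Nat.blt y b) ↔ a < b := by
  refine ⟨fun h => ?_, rank_lt_rank ha⟩
  by_contra hab
  rcases (not_lt.1 hab).eq_or_lt with e | hlt
  · simp [e] at h
  · exact absurd h (rank_lt_rank hb hlt).le.not_gt

theorem length_standardize (l : List ℕ) : (standardize l).length = l.length := by
  simp [standardize]

theorem lt_length_of_mem_standardize {l : List ℕ} {x : ℕ} (hx : x ∈ standardize l) :
    x < l.length := by
  obtain ⟨a, ha, rfl⟩ := List.mem_map.1 hx
  refine lt_of_lt_of_le (countP_lt_countP (q := fun _ => true) (fun _ _ _ => rfl)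
    ⟨a, ha, rfl, ?_⟩) (by simp)
  rw [← Bool.not_eq_true, Nat.blt_eq]; omega

theorem Occurrence.standardize {π : FinPerm} {M : List (Fin π.1 × ℕ)} (h : Occurrence π M) :
    ∃ M', Occurrence π M' ∧ M'.map Prod.snd = PermClass.standardize (M.map Prod.snd) := by
  refine ⟨_, h.relabel (fun x => (M.map Prod.snd).countP fun y => Nat.blt y x)
    (fun a ha b hb => rank_lt_rank_iff ha hb), ?_⟩
  simp [PermClass.standardize]

/-- The labels are distinct because they are ordered like the entries at distinct positions; being
below the length, they form a permutation. -/
theorem Occurrence.exists_contained {π : FinPerm} {M : List (Fin π.1 × ℕ)} (h : Occurrence π M)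
    (hM : ∀ x ∈ M.map Prod.snd, x < M.length) :
    ∃ σ, oneLine σ = M.map Prod.snd ∧ Contained σ π := by
  let g : Fin M.length → Fin M.length := fun i =>
    ⟨(M[i]).2, hM _ (List.mem_map_of_mem (List.getElem_mem i.2))⟩
  have hpos : ∀ i j : Fin M.length, i < j → (M[i]).1 < (M[j]).1 := fun i j hij =>
    ((List.pairwise_iff_getElem.1 h) i j i.2 j.2 hij).1
  have hg : ∀ i j : Fin M.length, g i < g j ↔ π.2 (M[i]).1 < π.2 (M[j]).1 := fun i j =>
    h.label_lt_iff (List.getElem_mem i.2) (List.getElem_mem j.2)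
  have hinj : Function.Injective g := by
    intro i j hij
    by_contra hne
    have hne' : (M[i]).1 ≠ (M[j]).1 := by
      rcases lt_or_gt_of_ne hne with hl | hl
      · exact (hpos _ _ hl).ne
      · exact (hpos _ _ hl).ne'
    rcases lt_or_gt_of_ne (fun e => hne' (π.2.injective e)) with hl | hl
    · exact absurd ((hg i j).2 hl) (by rw [hij]; exact lt_irrefl _)
    · exact absurd ((hg j i).2 hl) (by rw [hij]; exact lt_irrefl _)
  refine ⟨⟨M.length, Equiv.ofBijective g (Finite.injective_iff_bijective.1 hinj)⟩, ?_,
    fun i => (M[i]).1, fun i j hij => hpos i j hij, fun i j => hg i j⟩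
  apply List.ext_getElem
  · simp [oneLine]
  · intro i h1 h2
    simp [oneLine, g]

theorem Contained.exists_occurrence {σ π : FinPerm} {f : Fin σ.1 → Fin π.1} (hf : StrictMono f)
    (h : ∀ i j, σ.2 i < σ.2 j ↔ π.2 (f i) < π.2 (f j)) :
    Occurrence π (List.ofFn fun i => (f i, (σ.2 i : ℕ))) ∧
      (List.ofFn fun i => (f i, (σ.2 i : ℕ))).map Prod.snd = oneLine σ := by
  constructor
  · rw [Occurrence, List.pairwise_ofFn]
    intro i j hij
    exact ⟨hf hij, h i j, h j i⟩
  · rw [List.map_ofFn]; rfl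

theorem oneLine_injective (n : ℕ) :
    Function.Injective fun p : Equiv.Perm (Fin n) => oneLine ⟨n, p⟩ := by
  intro p q hpq
  have := List.ofFn_injective hpq
  ext i
  exact congrFun this i

theorem length_oneLine (π : FinPerm) : (oneLine π).length = π.1 := by simp [oneLine]

theorem lt_of_mem_oneLine {π : FinPerm} {x : ℕ} (hx : x ∈ oneLine π) : x < π.1 := by
  rw [oneLine, List.mem_ofFn] at hx
  obtain ⟨i, rfl⟩ := hx
  exact (π.2 i).2

/-! ### Direct sums -/

/-- The sum `σ ⊕ τ`. -/
def directSum (σ τ : FinPerm) : FinPerm :=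
  ⟨σ.1 + τ.1, finSumFinEquiv.permCongr (Equiv.sumCongr σ.2 τ.2)⟩

theorem directSum_castAdd (σ τ : FinPerm) (i : Fin σ.1) :
    (directSum σ τ).2 (Fin.castAdd τ.1 i) = Fin.castAdd τ.1 (σ.2 i) := by
  show finSumFinEquiv (Equiv.sumCongr σ.2 τ.2 (finSumFinEquiv.symm (Fin.castAdd τ.1 i))) = _
  simp

theorem directSum_natAdd (σ τ : FinPerm) (i : Fin τ.1) :
    (directSum σ τ).2 (Fin.natAdd σ.1 i) = Fin.natAdd σ.1 (τ.2 i) := by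
  show finSumFinEquiv (Equiv.sumCongr σ.2 τ.2 (finSumFinEquiv.symm (Fin.natAdd σ.1 i))) = _
  simp

theorem oneLine_directSum (σ τ : FinPerm) :
    oneLine (directSum σ τ) = oneLine σ ++ (oneLine τ).map (· + σ.1) := by
  have : oneLine (directSum σ τ) =
      List.ofFn (n := σ.1 + τ.1) fun i => ((directSum σ τ).2 i : ℕ) := rfl
  rw [this, List.ofFn_add]
  simp only [oneLine, List.map_ofFn]
  congr 1
  · congr 1; funext i
    exact congrArg Fin.val (directSum_castAdd σ τ i)
  · congr 1; funext i
    have := congrArg Fin.val (directSum_natAdd σ τ i)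
    simp only [Fin.val_natAdd] at this
    simp only [Function.comp]
    rw [add_comm]; exact this

/-- Injectivity follows from the order conditions on positions, so only surjectivity of the block
maps has to be supplied. -/
theorem isInflation_of_blocks {τ σ : FinPerm} {α : Fin σ.1 → FinPerm}
    (f : ∀ i, Fin (α i).1 → Fin τ.1) (hsurj : ∀ x, ∃ i a, f i a = x)
    (h1 : ∀ i j a b, i ≠ j → (f i a < f j b ↔ i < j))
    (h2 : ∀ i a b, f i a < f i b ↔ a < b)
    (h3 : ∀ i j a b, i ≠ j → (τ.2 (f i a) < τ.2 (f j b) ↔ σ.2 i < σ.2 j))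
    (h4 : ∀ i a b, τ.2 (f i a) < τ.2 (f i b) ↔ (α i).2 a < (α i).2 b) :
    IsInflation τ σ α := by
  refine ⟨Equiv.ofBijective (fun x => f x.1 x.2) ⟨?_, ?_⟩, h1, h2, h3, h4⟩
  · rintro ⟨i, a⟩ ⟨j, b⟩ hab
    simp only at hab
    by_cases hij : i = j
    · subst hij
      congr 1
      by_contra hne
      rcases lt_or_gt_of_ne hne with hl | hl
      · exact absurd ((h2 i a b).2 hl) (by rw [hab]; exact lt_irrefl _)
      · exact absurd ((h2 i b a).2 hl) (by rw [hab]; exact lt_irrefl _)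
    · rcases lt_or_gt_of_ne hij with hl | hl
      · exact absurd ((h1 i j a b hij).2 hl) (by rw [hab]; exact lt_irrefl _)
      · exact absurd ((h1 j i b a (Ne.symm hij)).2 hl) (by rw [hab]; exact lt_irrefl _)
  · intro x
    obtain ⟨i, a, h⟩ := hsurj x
    exact ⟨⟨i, a⟩, h⟩

theorem isSum_of_blocks {ρ σ τ : FinPerm} (f : Fin σ.1 → Fin ρ.1) (g : Fin τ.1 → Fin ρ.1)
    (hsurj : ∀ x, (∃ a, f a = x) ∨ ∃ b, g b = x)
    (h1 : ∀ a b, f a < g b) (hf : ∀ a b, f a < f b ↔ a < b) (hg : ∀ a b, g a < g b ↔ a < b)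
    (h2 : ∀ a b, ρ.2 (f a) < ρ.2 (g b))
    (hf' : ∀ a b, ρ.2 (f a) < ρ.2 (f b) ↔ σ.2 a < σ.2 b)
    (hg' : ∀ a b, ρ.2 (g a) < ρ.2 (g b) ↔ τ.2 a < τ.2 b) : IsSum ρ σ τ := by
  refine isInflation_of_blocks (σ := perm12) (α := ![σ, τ])
    (Fin.cons (α := fun i : Fin 2 => Fin (![σ, τ] i).1 → Fin ρ.1) f
      (Fin.cons (α := fun i : Fin 1 => Fin (![σ, τ] i.succ).1 → Fin ρ.1) g fun i => i.elim0))
    ?_ ?_ ?_ ?_ ?_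
  · intro x
    rcases hsurj x with ⟨a, h⟩ | ⟨b, h⟩
    · exact ⟨(0 : Fin 2), a, h⟩
    · exact ⟨(1 : Fin 2), b, h⟩
  · refine Fin.forall_fin_two.2 ⟨Fin.forall_fin_two.2 ⟨fun a b h => absurd rfl h, ?_⟩,
      Fin.forall_fin_two.2 ⟨?_, fun a b h => absurd rfl h⟩⟩
    · exact fun a b _ => ⟨fun _ => by decide, fun _ => h1 a b⟩
    · exact fun a b _ => ⟨fun h => absurd h (h1 b a).le.not_gt, fun h => absurd h (by decide)⟩
  · exact Fin.forall_fin_two.2 ⟨hf, hg⟩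
  · refine Fin.forall_fin_two.2 ⟨Fin.forall_fin_two.2 ⟨fun a b h => absurd rfl h, ?_⟩,
      Fin.forall_fin_two.2 ⟨?_, fun a b h => absurd rfl h⟩⟩
    · exact fun a b _ => ⟨fun _ => by decide, fun _ => h2 a b⟩
    · exact fun a b _ => ⟨fun h => absurd h (h2 b a).le.not_gt, fun h => absurd h (by decide)⟩
  · exact Fin.forall_fin_two.2 ⟨hf', hg'⟩

theorem isSum_directSum (σ τ : FinPerm) : IsSum (directSum σ τ) σ τ := by
  have key : ∀ (a : Fin σ.1) (b : Fin τ.1), Fin.castAdd τ.1 a < Fin.natAdd σ.1 b := by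
    intro a b
    rw [Fin.lt_def, Fin.val_castAdd, Fin.val_natAdd]
    omega
  refine isSum_of_blocks (ρ := directSum σ τ) (fun a => Fin.castAdd τ.1 a)
    (fun b => Fin.natAdd σ.1 b) ?_ key ?_ ?_ ?_ ?_ ?_
  · intro x
    exact Fin.addCases (fun i => Or.inl ⟨i, rfl⟩) (fun i => Or.inr ⟨i, rfl⟩) x
  · exact fun a b => Iff.rfl
  · exact fun a b => Nat.add_lt_add_iff_left
  · intro a b
    rw [directSum_castAdd, directSum_natAdd]
    exact key _ _
  · intro a b
    rw [directSum_castAdd, directSum_castAdd]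
    exact Iff.rfl
  · intro a b
    rw [directSum_natAdd, directSum_natAdd]
    exact Nat.add_lt_add_iff_left

/-! ### Growth of sum closed classes -/

/-- The one-line notations of the members of length `n` of `C`. -/
def words (C : Set FinPerm) (n : ℕ) : Set (List ℕ) :=
  (fun p : Equiv.Perm (Fin n) => oneLine ⟨n, p⟩) '' {p | (⟨n, p⟩ : FinPerm) ∈ C}

theorem finite_words (C : Set FinPerm) (n : ℕ) : (words C n).Finite :=
  (Set.toFinite _).image _

theorem ncard_words (C : Set FinPerm) (n : ℕ) : (words C n).ncard = speed C n :=
  Set.ncard_image_of_injective _ (oneLine_injective n)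

theorem oneLine_mem_words {C : Set FinPerm} {π : FinPerm} (h : π ∈ C) :
    oneLine π ∈ words C π.1 := ⟨π.2, h, rfl⟩

theorem exists_of_mem_words {C : Set FinPerm} {n : ℕ} {w : List ℕ} (h : w ∈ words C n) :
    ∃ π ∈ C, π.1 = n ∧ oneLine π = w := by
  obtain ⟨p, hp, rfl⟩ := h
  exact ⟨⟨n, p⟩, hp, rfl, rfl⟩

theorem exists_le_of_sumIndecomposable {l : List ℕ} (h : sumIndecomposable l = true) {k : ℕ}
    (h0 : 0 < k) (hk : k < l.length) : ∃ x ∈ l.take k, k ≤ x := by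
  have := List.all_eq_true.1 h k (List.mem_range.2 hk)
  rw [Bool.or_eq_true, List.any_eq_true] at this
  rcases this with h | ⟨x, hx, hkx⟩
  · exact absurd (Nat.eq_of_beq_eq_true h) h0.ne'
  · exact ⟨x, hx, Nat.le_of_ble_eq_true hkx⟩

/-- Otherwise `p` would be a proper prefix of `q` with all letters below its own length, and `q`
would be decomposable. -/
theorem length_le_of_append_eq {p q w z : List ℕ} (hp0 : p ≠ []) (hp : ∀ x ∈ p, x < p.length)
    (hq : sumIndecomposable q = true) (h : p ++ w = q ++ z) : q.length ≤ p.length := by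
  by_contra! hlt
  obtain ⟨x, hx, hpx⟩ :=
    exists_le_of_sumIndecomposable hq (List.length_pos_iff.2 hp0) hlt
  have : q.take p.length = p := by
    rw [← List.take_append_of_le_length hlt.le (l₂ := z), ← h, List.take_left']
    rfl
  rw [this] at hx
  exact absurd (hp x hx) hpx.not_gt

/-- Uniqueness of the first sum indecomposable component; this makes the counting below free of
repetitions. -/
theorem append_shift_injective {p q w z : List ℕ} (hp0 : p ≠ []) (hq0 : q ≠ [])
    (hp : ∀ x ∈ p, x < p.length) (hq : ∀ x ∈ q, x < q.length)
    (hpi : sumIndecomposable p = true) (hqi : sumIndecomposable q = true)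
    (h : p ++ w.map (· + p.length) = q ++ z.map (· + q.length)) : p = q ∧ w = z := by
  have hlen : p.length = q.length :=
    le_antisymm (length_le_of_append_eq hq0 hq hpi h.symm) (length_le_of_append_eq hp0 hp hqi h)
  obtain ⟨rfl, h2⟩ := List.append_inj h hlen
  exact ⟨rfl, List.map_injective_iff.2 (fun a b hab => Nat.add_right_cancel hab) h2⟩

section Growth

variable {C : Set FinPerm} {X : Finset (List ℕ)}

/-- Prepending `q` to the members of length `n - q.length` is injective, and different `q` give
disjoint sets of members of length `n`. -/
theorem sum_speed_le (hC : SumClosed C) (hX0 : ∀ q ∈ X, q ≠ [])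
    (hXi : ∀ q ∈ X, sumIndecomposable q = true) (hXC : ∀ q ∈ X, ∃ σ ∈ C, oneLine σ = q) {n : ℕ}
    (hn : ∀ q ∈ X, q.length ≤ n) : ∑ q ∈ X, speed C (n - q.length) ≤ speed C n := by
  classical
  have hlt : ∀ q ∈ X, ∀ x ∈ q, x < q.length := by
    intro q hq x hx
    obtain ⟨σ, -, rfl⟩ := hXC q hq
    rw [length_oneLine]
    exact lt_of_mem_oneLine hx
  have hcard : ∀ k, speed C k = (finite_words C k).toFinset.card := by
    intro k
    rw [← ncard_words, Set.ncard_eq_toFinset_card _ (finite_words C k)]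
  have hsub : X.biUnion (fun q => (finite_words C (n - q.length)).toFinset.image
      fun w => q ++ w.map (· + q.length)) ⊆ (finite_words C n).toFinset := by
    intro u hu
    simp only [Finset.mem_biUnion, Finset.mem_image, Set.Finite.mem_toFinset] at hu ⊢
    obtain ⟨q, hq, w, hw, rfl⟩ := hu
    obtain ⟨σ, hσ, rfl⟩ := hXC q hq
    obtain ⟨τ, hτ, hτn, rfl⟩ := exists_of_mem_words hw
    have := oneLine_mem_words (hC σ hσ τ hτ _ (isSum_directSum σ τ))
    have hl := hn _ hq
    rw [length_oneLine] at hτn hl ⊢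
    rwa [oneLine_directSum, show (directSum σ τ).1 = n by
      show σ.1 + τ.1 = n
      omega] at this
  calc ∑ q ∈ X, speed C (n - q.length)
      = ∑ q ∈ X, ((finite_words C (n - q.length)).toFinset.image
          fun w => q ++ w.map (· + q.length)).card := by
        refine Finset.sum_congr rfl fun q hq => ?_
        rw [hcard, Finset.card_image_of_injective]
        intro w z hwz
        exact (append_shift_injective (hX0 q hq) (hX0 q hq) (hlt q hq) (hlt q hq) (hXi q hq)
          (hXi q hq) hwz).2
    _ = _ := by
        refine (Finset.card_biUnion fun p hp q hq hpq => ?_).symm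
        rw [Function.onFun, Finset.disjoint_left]
        intro u hu hu'
        simp only [Finset.mem_image] at hu hu'
        obtain ⟨w, -, rfl⟩ := hu
        obtain ⟨z, -, hz⟩ := hu'
        exact hpq (append_shift_injective (hX0 p hp) (hX0 q hq) (hlt p hp) (hlt q hq) (hXi p hp)
          (hXi q hq) hz.symm).1
    _ ≤ speed C n := by
        rw [hcard n]
        exact Finset.card_le_card hsub

/-- Strong induction through the recurrence of `sum_speed_le`. The factor `γ ^ N` absorbs the
lengths below `N`, where positivity of the counting sequence suffices. -/
theorem pow_le_mul_speed (hC : SumClosed C) (hX0 : ∀ q ∈ X, q ≠ [])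
    (hXi : ∀ q ∈ X, sumIndecomposable q = true) (hXC : ∀ q ∈ X, ∃ σ ∈ C, oneLine σ = q)
    (h0 : [0] ∈ X) (hempty : ∃ σ ∈ C, σ.1 = 0) {N : ℕ} (hN : ∀ q ∈ X, q.length ≤ N) {γ : ℝ}
    (hγ : 1 ≤ γ) (hX : 1 ≤ ∑ q ∈ X, (γ ^ q.length)⁻¹) (n : ℕ) :
    γ ^ n ≤ γ ^ N * speed C n := by
  have hγ0 : 0 < γ := lt_of_lt_of_le one_pos hγ
  have hpos : ∀ n, 1 ≤ speed C n := by
    intro n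
    induction n with
    | zero =>
      obtain ⟨⟨m, p⟩, hσ, hm⟩ := hempty
      obtain rfl : m = 0 := hm
      rw [← ncard_words, Nat.one_le_iff_ne_zero, Ne, Set.ncard_eq_zero (finite_words C 0)]
      exact Set.Nonempty.ne_empty ⟨_, oneLine_mem_words hσ⟩
    | succ n ih =>
      -- Used with `[0]` alone, the recurrence says that the counting sequence is nondecreasing.
      have := sum_speed_le (X := {[0]}) hC (fun q hq => hX0 q (by simp_all))
        (fun q hq => hXi q (by simp_all)) (fun q hq => hXC q (by simp_all)) (n := n + 1)
        (fun q hq => by simp_all)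
      simp at this
      omega
  induction n using Nat.strong_induction_on with
  | _ n ih =>
    by_cases hn : n < N
    · calc γ ^ n ≤ γ ^ N := pow_le_pow_right₀ hγ hn.le
        _ = γ ^ N * 1 := (mul_one _).symm
        _ ≤ γ ^ N * speed C n := by
          gcongr
          exact_mod_cast hpos n
    · have hle : ∀ q ∈ X, q.length ≤ n := fun q hq => (hN q hq).trans (not_lt.1 hn)
      have hrec : (∑ q ∈ X, (speed C (n - q.length) : ℝ)) ≤ speed C n := by
        exact_mod_cast sum_speed_le hC hX0 hXi hXC hle
      calc γ ^ n = γ ^ n * 1 := (mul_one _).symm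
        _ ≤ γ ^ n * ∑ q ∈ X, (γ ^ q.length)⁻¹ := by gcongr
        _ = ∑ q ∈ X, γ ^ (n - q.length) := by
          rw [Finset.mul_sum]
          refine Finset.sum_congr rfl fun q hq => ?_
          rw [pow_sub₀ _ hγ0.ne' (hle q hq)]
        _ ≤ ∑ q ∈ X, γ ^ N * speed C (n - q.length) := by
          refine Finset.sum_le_sum fun q hq => ih _ ?_
          have := hle q hq
          have := List.length_pos_iff.2 (hX0 q hq)
          omega
        _ = γ ^ N * ∑ q ∈ X, (speed C (n - q.length) : ℝ) := by rw [Finset.mul_sum]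
        _ ≤ γ ^ N * speed C n := by gcongr

end Growth

/-- If the upper growth rate were below some `r < γ`, then `(γ / r) ^ n` would stay bounded by `γ ^
N`, although it diverges. -/
theorem ofReal_le_upperGrowthRate {C : Set FinPerm} {γ : ℝ} (hγ : 0 < γ) {N : ℕ}
    (h : ∀ n, γ ^ n ≤ γ ^ N * speed C n) : ENNReal.ofReal γ ≤ upperGrowthRate C := by
  by_contra! hlt
  obtain ⟨r, hr1, hr2⟩ := exists_between hlt
  have hrtop : r ≠ ⊤ := (hr2.trans ENNReal.ofReal_lt_top).ne
  have hr0 : 0 < r.toReal := ENNReal.toReal_pos (bot_le.trans_lt hr1).ne' hrtop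
  have hrγ : r.toReal < γ := (ENNReal.lt_ofReal_iff_toReal_lt hrtop).1 hr2
  have hev : ∀ᶠ n : ℕ in atTop, (γ / r.toReal) ^ n ≤ γ ^ N := by
    filter_upwards [eventually_lt_of_limsup_lt hr1, eventually_gt_atTop 0] with n hn hn0
    have h1 : (speed C n : ℝ≥0∞) ≤ r ^ n := by
      have h2 := ENNReal.rpow_le_rpow hn.le (Nat.cast_nonneg (α := ℝ) n)
      rwa [← ENNReal.rpow_mul, one_div, inv_mul_cancel₀ (by exact_mod_cast hn0.ne'),
        ENNReal.rpow_one, ENNReal.rpow_natCast] at h2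
    have h3 : (speed C n : ℝ) ≤ r.toReal ^ n := by
      have := ENNReal.toReal_mono (ENNReal.pow_ne_top hrtop) h1
      simpa using this
    rw [div_pow, div_le_iff₀ (by positivity)]
    exact (h n).trans (by gcongr)
  have htend := tendsto_pow_atTop_atTop_of_one_lt ((one_lt_div hr0).2 hrγ)
  obtain ⟨n, h1, h2⟩ := (hev.and (htend.eventually_gt_atTop (γ ^ N))).exists
  exact absurd h1 h2.not_ge

/-! ### Correctness of the growth test -/

theorem withLetters_eq {β : Type} (l : List ℕ) (k : List ℕ → β) : withLetters l k = k l := by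
  induction l generalizing k with
  | nil => rfl
  | cons a l ih => cases a <;> exact ih _

theorem sameWord_iff {p q : List ℕ} : sameWord p q = true ↔ p = q := by
  induction p generalizing q with
  | nil => cases q <;> simp [sameWord]
  | cons a p ih => cases q <;> simp [sameWord, ih]

theorem sumIndecomposables_spec (l : List ℕ) : (sumIndecomposables l).Nodup ∧
    ∀ q ∈ sumIndecomposables l, q ≠ [] ∧ sumIndecomposable q = true ∧
      ∃ s, s.Sublist l ∧ q = standardize s := by
  have key : ∀ (L R : List (List ℕ)), (∀ s ∈ L, s.Sublist l) →
      (R.Nodup ∧ ∀ q ∈ R, q ≠ [] ∧ sumIndecomposable q = true ∧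
        ∃ s, s.Sublist l ∧ q = standardize s) →
      (L.foldl (fun R q => withLetters (standardize q) fun q' => addIndecomposable q' R) R).Nodup ∧
        ∀ q ∈ L.foldl (fun R q => withLetters (standardize q) fun q' => addIndecomposable q' R) R,
          q ≠ [] ∧ sumIndecomposable q = true ∧ ∃ s, s.Sublist l ∧ q = standardize s := by
    intro L
    induction L with
    | nil => exact fun R _ h => h
    | cons s L ih =>
      intro R hL hR
      rw [List.foldl_cons]
      refine ih _ (fun s hs => hL s (List.mem_cons_of_mem _ hs)) ?_
      rw [withLetters_eq, addIndecomposable]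
      split_ifs with hs
      · simp only [Bool.and_eq_true, Bool.not_eq_true', List.isEmpty_eq_false_iff] at hs
        refine ⟨List.nodup_cons.2 ⟨fun hmem => ?_, hR.1⟩, ?_⟩
        · have := hs.2.2
          rw [List.any_eq_false] at this
          exact this _ hmem (sameWord_iff.2 rfl)
        · intro q hq
          rcases List.mem_cons.1 hq with rfl | hq
          · exact ⟨hs.1, hs.2.1, s, hL s List.mem_cons_self, rfl⟩
          · exact hR.2 q hq
      · exact hR
  exact key _ _ (fun s hs => List.mem_sublists.1 hs) ⟨List.nodup_nil, by simp⟩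

theorem subset_sumClosure (C : Set FinPerm) : C ⊆ sumClosure C :=
  Set.subset_sInter fun _ hD => hD.2.2

theorem sumClosed_sumClosure (C : Set FinPerm) : SumClosed (sumClosure C) := by
  intro π hπ σ hσ τ hτ D hD
  exact hD.2.1 π (hπ D hD) σ (hσ D hD) τ hτ

theorem Occurrence.exists_sublist {π : FinPerm} {M : List (Fin π.1 × ℕ)} (h : Occurrence π M)
    {s : List ℕ} (hs : s.Sublist (M.map Prod.snd)) :
    ∃ M', Occurrence π M' ∧ M'.map Prod.snd = s := by
  obtain ⟨M', hM', rfl⟩ := List.sublist_map_iff.1 hs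
  exact ⟨M', h.sublist hM', rfl⟩

theorem Occurrence.exists_standardize {π : FinPerm} {M : List (Fin π.1 × ℕ)} (h : Occurrence π M)
    {s : List ℕ} (hs : s.Sublist (M.map Prod.snd)) :
    ∃ σ, oneLine σ = PermClass.standardize s ∧ Contained σ π := by
  obtain ⟨M', hM', rfl⟩ := h.exists_sublist hs
  obtain ⟨M'', h1, h2⟩ := hM'.standardize
  rw [← h2]
  refine h1.exists_contained fun x hx => ?_
  rw [h2] at hx
  have := lt_length_of_mem_standardize hx
  rwa [← length_standardize, ← h2, List.length_map] at this

theorem Occurrence.le_upperGrowthRate {π : FinPerm} {M : List (Fin π.1 × ℕ)}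
    (h : Occurrence π M) (hM : forcesGrowth (M.map Prod.snd) = true) :
    ENNReal.ofReal 2.36 ≤ upperGrowthRate (sumClosure (Sub π)) := by
  obtain ⟨hnd, hspec⟩ := sumIndecomposables_spec (M.map Prod.snd)
  rw [forcesGrowth, Bool.and_eq_true, List.any_eq_true] at hM
  obtain ⟨⟨q₀, hq₀, hq₀'⟩, hsum⟩ := hM
  rw [sameWord_iff] at hq₀'
  subst hq₀'
  set l := M.map Prod.snd with hl
  have hlen : ∀ q ∈ (sumIndecomposables l).toFinset, q.length ≤ l.length := by
    intro q hq
    obtain ⟨-, -, s, hs, rfl⟩ := hspec q (List.mem_toFinset.1 hq)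
    rw [length_standardize]
    exact hs.length_le
  refine ofReal_le_upperGrowthRate (by norm_num) (N := l.length) fun n =>
    pow_le_mul_speed (X := (sumIndecomposables l).toFinset) (sumClosed_sumClosure _)
      (fun q hq => (hspec q (List.mem_toFinset.1 hq)).1)
      (fun q hq => (hspec q (List.mem_toFinset.1 hq)).2.1) (fun q hq => ?_)
      (List.mem_toFinset.2 hq₀) ?_ hlen (by norm_num) ?_ n
  · obtain ⟨-, -, s, hs, rfl⟩ := hspec q (List.mem_toFinset.1 hq)
    obtain ⟨σ, h1, h2⟩ := h.exists_standardize hs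
    exact ⟨σ, subset_sumClosure _ h2, h1⟩
  -- The empty pattern supplies the member of length `0`.
  · obtain ⟨σ, h1, h2⟩ := h.exists_standardize (List.nil_sublist _)
    refine ⟨σ, subset_sumClosure _ h2, ?_⟩
    rw [← length_oneLine, h1]
    rfl
  · have h1 : 59 ^ l.length ≤ ∑ q ∈ (sumIndecomposables l).toFinset,
        25 ^ q.length * 59 ^ (l.length - q.length) := by
      rw [List.sum_toFinset _ hnd]
      exact Nat.le_of_ble_eq_true hsum
    have h2 : (59 : ℝ) ^ l.length ≤ ∑ q ∈ (sumIndecomposables l).toFinset,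
        (25 : ℝ) ^ q.length * 59 ^ (l.length - q.length) := by exact_mod_cast h1
    have h3 : (∑ q ∈ (sumIndecomposables l).toFinset,
        (25 : ℝ) ^ q.length * 59 ^ (l.length - q.length)) =
        59 ^ l.length * ∑ q ∈ (sumIndecomposables l).toFinset, ((2.36 : ℝ) ^ q.length)⁻¹ := by
      rw [Finset.mul_sum]
      refine Finset.sum_congr rfl fun q hq => ?_
      rw [pow_sub₀ _ (by norm_num) (hlen q hq), show (2.36 : ℝ) = 59 / 25 by norm_num, div_pow,
        inv_div]
      ring
    rw [h3] at h2
    exact le_of_mul_le_mul_left (by simpa using h2) (by positivity : (0 : ℝ) < 59 ^ l.length)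

/-! ### Low growth and reversal -/

/-- No pattern of `π` forces the growth rate of the sum closure of `Sub π` to be at least
`2.36`. -/
def LowGrowth (π : FinPerm) : Prop :=
  ∀ M, Occurrence π M → forcesGrowth (M.map Prod.snd) = false

theorem lowGrowth_of_upperGrowthRate_lt {π : FinPerm}
    (h : upperGrowthRate (sumClosure (Sub π)) < ENNReal.ofReal 2.36) : LowGrowth π := by
  intro M hM
  rw [← Bool.not_eq_true]
  exact fun hf => absurd h (hM.le_upperGrowthRate hf).not_gt

theorem Occurrence.of_contained {σ π : FinPerm} {f : Fin σ.1 → Fin π.1} (hf : StrictMono f)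
    (h : ∀ i j, σ.2 i < σ.2 j ↔ π.2 (f i) < π.2 (f j)) {M : List (Fin σ.1 × ℕ)}
    (hM : Occurrence σ M) : Occurrence π (M.map fun a => (f a.1, a.2)) := by
  rw [Occurrence, List.pairwise_map]
  exact List.Pairwise.imp (fun {a b} hab => ⟨hf hab.1, hab.2.1.trans (h _ _),
    hab.2.2.trans (h _ _)⟩) hM

theorem LowGrowth.of_contained {σ π : FinPerm} (h : LowGrowth π) (hσ : Contained σ π) :
    LowGrowth σ := by
  obtain ⟨f, hf, hfπ⟩ := hσ
  intro M hM
  have := h _ (hM.of_contained hf hfπ)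
  rwa [List.map_map] at this

/-- The reverse of `π`. -/
abbrev reverse (π : FinPerm) : FinPerm := ⟨π.1, Fin.revPerm.trans π.2⟩

theorem reverse_apply (π : FinPerm) (i : Fin π.1) : (reverse π).2 i = π.2 i.rev := rfl

theorem reverse_reverse (π : FinPerm) : reverse (reverse π) = π := by
  obtain ⟨n, p⟩ := π
  refine Sigma.ext rfl (heq_of_eq ?_)
  ext i
  show ((p (Fin.rev (Fin.rev i))) : ℕ) = p i
  rw [Fin.rev_rev]

theorem Contained.reverse {σ π : FinPerm} (h : Contained σ π) :
    Contained (reverse σ) (reverse π) := by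
  obtain ⟨f, hf, hfπ⟩ := h
  refine ⟨fun i => (f i.rev).rev, fun i j hij => ?_, fun i j => ?_⟩
  · exact Fin.rev_lt_rev.2 (hf (Fin.rev_lt_rev.2 hij))
  · rw [reverse_apply, reverse_apply, reverse_apply, reverse_apply, Fin.rev_rev, Fin.rev_rev]
    exact hfπ _ _

/-- The reversed outer permutation is a parameter `p`, so that it can be given as a literal such as
`21`. -/
theorem IsInflation.reverse {τ σ : FinPerm} {α : Fin σ.1 → FinPerm} (h : IsInflation τ σ α)
    (p : Equiv.Perm (Fin σ.1)) (hp : ∀ i, p i = σ.2 i.rev) :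
    IsInflation (reverse τ) ⟨σ.1, p⟩ fun i => reverse (α i.rev) := by
  obtain ⟨e, h1, h2, h3, h4⟩ := h
  refine isInflation_of_blocks (τ := PermClass.reverse τ) (σ := ⟨σ.1, p⟩)
    (α := fun i => PermClass.reverse (α i.rev))
    (fun i a => (e ⟨i.rev, a.rev⟩).rev) ?_ ?_ ?_ ?_ ?_
  · intro x
    obtain ⟨⟨i, a⟩, hx⟩ := e.surjective x.rev
    obtain ⟨i, rfl⟩ := Fin.rev_surjective i
    obtain ⟨a, rfl⟩ := Fin.rev_surjective a
    exact ⟨i, a, by rw [hx, Fin.rev_rev]⟩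
  · intro i j a b hij
    rw [Fin.rev_lt_rev, h1 _ _ _ _ (fun h => hij (Fin.rev_injective h).symm), Fin.rev_lt_rev]
  · intro i a b
    rw [Fin.rev_lt_rev, h2, Fin.rev_lt_rev]
  · intro i j a b hij
    rw [reverse_apply, reverse_apply, Fin.rev_rev, Fin.rev_rev,
      h3 _ _ _ _ (fun h => hij (Fin.rev_injective h)), hp, hp]
  · intro i a b
    rw [reverse_apply, reverse_apply, Fin.rev_rev, Fin.rev_rev, h4]
    rfl

theorem IsSum.reverse {τ π σ : FinPerm} (h : IsSum τ π σ) :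
    IsSkewSum (reverse τ) (reverse σ) (reverse π) := by
  have := IsInflation.reverse h perm21.2 (by decide)
  have e : (fun i : Fin 2 => PermClass.reverse ((![π, σ] : Fin 2 → FinPerm) i.rev)) =
      ![PermClass.reverse σ, PermClass.reverse π] := by
    funext i
    fin_cases i <;> rfl
  unfold IsSkewSum
  rw [← e]
  exact this

/-- The preimage under reversal of a skew closed class containing `Sub π` is a sum closed class
containing `Sub (reverse π)`. -/
theorem reverse_mem_skewClosure {π τ : FinPerm} (h : τ ∈ sumClosure (Sub (reverse π))) :
    reverse τ ∈ skewClosure (Sub π) := by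
  intro D hD
  refine h {τ | reverse τ ∈ D} ⟨?_, ?_, ?_⟩
  · exact fun σ π hσ hπ => hD.1 _ _ hσ.reverse hπ
  · exact fun π hπ σ hσ τ hτ => hD.2.1 _ hσ _ hπ _ (IsSum.reverse hτ)
  · intro σ hσ
    refine hD.2.2 (?_ : Contained _ _)
    have := Contained.reverse hσ
    rwa [reverse_reverse] at this

theorem upperGrowthRate_sumClosure_reverse_le (π : FinPerm) :
    upperGrowthRate (sumClosure (Sub (reverse π))) ≤ upperGrowthRate (skewClosure (Sub π)) := by
  refine limsup_le_limsup (Eventually.of_forall fun n => ?_)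
  refine ENNReal.rpow_le_rpow ?_ (by positivity)
  have : speed (sumClosure (Sub (reverse π))) n ≤ speed (skewClosure (Sub π)) n := by
    refine Set.ncard_le_ncard_of_injOn (fun p => Fin.revPerm.trans p) (fun p hp => ?_) ?_
      (Set.toFinite _)
    · exact reverse_mem_skewClosure hp
    · intro p _ q _ hpq
      ext i
      have := congrArg (fun r : Equiv.Perm (Fin n) => ((r i.rev : Fin n) : ℕ)) hpq
      simpa using this
  exact_mod_cast this

theorem lowGrowth_or_of_mem_cellClass {π : FinPerm} (h : π ∈ cellClass 2.36) :
    LowGrowth π ∨ LowGrowth (reverse π) := by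
  rcases h with ⟨g, ⟨hg, -⟩, hlt⟩ | ⟨g, ⟨hg, -⟩, hlt⟩
  · exact Or.inl (lowGrowth_of_upperGrowthRate_lt (hg ▸ hlt))
  · exact Or.inr (lowGrowth_of_upperGrowthRate_lt
      ((upperGrowthRate_sumClosure_reverse_le π).trans_lt (hg ▸ hlt)))

/-! ### Inserting an entry and splitting a block -/

theorem exists_split_positions {n : ℕ} {M : List (Fin n × ℕ)}
    (hM : M.Pairwise fun a b => a.1 < b.1) {x : Fin n} (hx : ∀ a ∈ M, a.1 ≠ x) :
    ∃ M₁ M₂, M = M₁ ++ M₂ ∧ (∀ a ∈ M₁, a.1 < x) ∧ ∀ a ∈ M₂, x < a.1 := by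
  induction M with
  | nil => exact ⟨[], [], rfl, by simp, by simp⟩
  | cons a M ih =>
    rw [List.pairwise_cons] at hM
    rcases lt_or_gt_of_ne (hx a List.mem_cons_self) with h | h
    · obtain ⟨M₁, M₂, rfl, h1, h2⟩ := ih hM.2 fun b hb => hx b (List.mem_cons_of_mem _ hb)
      refine ⟨a :: M₁, M₂, rfl, fun b hb => ?_, h2⟩
      rcases List.mem_cons.1 hb with rfl | hb
      · exact h
      · exact h1 b hb
    · refine ⟨[], a :: M, rfl, by simp, fun b hb => ?_⟩
      rcases List.mem_cons.1 hb with rfl | hb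
      · exact h
      · exact h.trans (hM.1 b hb)

theorem shift_eq (v w : ℕ) :
    (bif Nat.blt w v then w else w + 1) = if w < v then w else w + 1 := by
  by_cases h : w < v
  · rw [if_pos h, Nat.blt_eq.mpr h, cond_true]
  · rw [if_neg h, Bool.eq_false_iff.2 (fun h' => h (Nat.blt_eq.mp h')), cond_false]

theorem shift_lt_shift (v a b : ℕ) :
    ((bif Nat.blt a v then a else a + 1) < bif Nat.blt b v then b else b + 1) ↔ a < b := by
  rw [shift_eq, shift_eq]
  split_ifs <;> omega

theorem shift_lt (v a : ℕ) : (bif Nat.blt a v then a else a + 1) < v ↔ a < v := by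
  rw [shift_eq]
  split_ifs <;> omega

theorem lt_shift (v a : ℕ) : v < (bif Nat.blt a v then a else a + 1) ↔ v ≤ a := by
  rw [shift_eq]
  split_ifs <;> omega

/-- The label `v` is one more than the largest label of an entry below `x`, or `0` if there is none;
the labels from `v` on move up by one. So finitely many candidates for `v` cover all cases. -/
theorem Occurrence.exists_insert {π : FinPerm} {M : List (Fin π.1 × ℕ)} (h : Occurrence π M)
    {x : Fin π.1} (hx : ∀ a ∈ M, a.1 ≠ x) :
    ∃ M₁ M₂ v, M = M₁ ++ M₂ ∧ (∀ a ∈ M₁, a.1 < x) ∧ (∀ a ∈ M₂, x < a.1) ∧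
      v ∈ 0 :: (M.map Prod.snd).map (· + 1) ∧ (∀ a ∈ M, a.2 < v ↔ π.2 a.1 < π.2 x) ∧
      ∃ M', Occurrence π M' ∧
        M'.map Prod.snd = insertLetter (M₁.map Prod.snd) (M₂.map Prod.snd) v := by
  classical
  obtain ⟨M₁, M₂, rfl, h1, h2⟩ := exists_split_positions (List.Pairwise.imp (fun h => h.1) h) hx
  have hv : ∃ v, v ∈ 0 :: ((M₁ ++ M₂).map Prod.snd).map (· + 1) ∧
      ∀ a ∈ M₁ ++ M₂, a.2 < v ↔ π.2 a.1 < π.2 x := by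
    by_cases hne : ((M₁ ++ M₂).toFinset.filter fun a => π.2 a.1 < π.2 x).Nonempty
    · obtain ⟨m, hm, hmax⟩ := Finset.exists_max_image _ Prod.snd hne
      simp only [Finset.mem_filter, List.mem_toFinset] at hm hmax
      refine ⟨m.2 + 1, List.mem_cons_of_mem _
        (List.mem_map_of_mem (List.mem_map_of_mem hm.1)), fun a ha => ⟨fun hlt => ?_, fun hlt => ?_⟩⟩
      · have : ¬ π.2 m.1 < π.2 a.1 := fun h' =>
          absurd ((h.label_lt_iff hm.1 ha).2 h') (by omega)
        exact (not_lt.1 this).trans_lt hm.2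
      · exact Nat.lt_succ_of_le (hmax a ⟨ha, hlt⟩)
    · refine ⟨0, List.mem_cons_self, fun a ha => ⟨fun h => absurd h (Nat.not_lt_zero _),
        fun hlt => absurd ⟨a, ?_⟩ hne⟩⟩
      simp only [Finset.mem_filter, List.mem_toFinset]
      exact ⟨ha, hlt⟩
  obtain ⟨v, hv, hvx⟩ := hv
  have hvx' : ∀ a ∈ M₁ ++ M₂, v ≤ a.2 ↔ π.2 x < π.2 a.1 := by
    intro a ha
    rw [← not_lt, hvx a ha, not_lt]
    exact ⟨fun hle => lt_of_le_of_ne hle fun e => hx a ha (π.2.injective e).symm, le_of_lt⟩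
  refine ⟨M₁, M₂, v, rfl, h1, h2, hv, hvx,
    M₁.map (fun a => (a.1, bif Nat.blt a.2 v then a.2 else a.2 + 1)) ++
      (x, v) :: M₂.map (fun a => (a.1, bif Nat.blt a.2 v then a.2 else a.2 + 1)), ?_, ?_⟩
  · have h' := h.relabel (fun w => bif Nat.blt w v then w else w + 1)
      (fun a _ b _ => shift_lt_shift v a b)
    rw [Occurrence, List.map_append, List.pairwise_append] at h'
    rw [Occurrence, List.pairwise_append, List.pairwise_cons]
    refine ⟨h'.1, ⟨fun b hb => ?_, h'.2.1⟩, fun a ha b hb => ?_⟩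
    · obtain ⟨b, hb₀, rfl⟩ := List.mem_map.1 hb
      have hb' := List.mem_append_right M₁ hb₀
      exact ⟨h2 b hb₀, (lt_shift _ _).trans (hvx' b hb'), (shift_lt _ _).trans (hvx b hb')⟩
    · rcases List.mem_cons.1 hb with rfl | hb
      · obtain ⟨a, ha₀, rfl⟩ := List.mem_map.1 ha
        have ha' := List.mem_append_left M₂ ha₀
        exact ⟨h1 a ha₀, (shift_lt _ _).trans (hvx a ha'), (lt_shift _ _).trans (hvx' a ha')⟩
      · exact h'.2.2 a ha b hb
  · simp only [insertLetter, List.map_append, List.map_cons, List.map_map]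
    rfl

theorem splitsPositions_iff {S l₁ l₂ : List ℕ} :
    splitsPositions S l₁ l₂ = true ↔ (∃ w ∈ l₁, w ∈ S) ∧ ∃ w ∈ l₂, w ∈ S := by
  simp [splitsPositions]

theorem splitsValues_iff {S l : List ℕ} {v : ℕ} :
    splitsValues S l v = true ↔ (∃ w ∈ l, w ∈ S ∧ w < v) ∧ ∃ w ∈ l, w ∈ S ∧ v ≤ w := by
  simp only [splitsValues, Bool.and_eq_true, List.any_eq_true, List.contains_iff_mem, Nat.blt_eq,
    Nat.ble_eq]

/-- `PS` and `VS` are the hulls of the block in positions and in values. If they agreed everywhere,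
the hull would be an interval with at least two entries, missing an entry of `M` outside the block;
this contradicts simplicity. So some `x` lies in exactly one hull. -/
theorem Occurrence.exists_splitting {π : FinPerm} (hπ : IsSimple π) {M : List (Fin π.1 × ℕ)}
    (h : Occurrence π M) {S : List ℕ} (hS : isProperBlock S (M.map Prod.snd) = true) :
    ∃ t ∈ List.range ((M.map Prod.snd).length + 1), ∃ v ∈ 0 :: (M.map Prod.snd).map (· + 1),
      (splitsPositions S ((M.map Prod.snd).take t) ((M.map Prod.snd).drop t) ^^
        splitsValues S (M.map Prod.snd) v) = true ∧
      ∃ M', Occurrence π M' ∧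
        M'.map Prod.snd =
          insertLetter ((M.map Prod.snd).take t) ((M.map Prod.snd).drop t) v := by
  simp only [isProperBlock, Bool.and_eq_true, List.any_eq_true, List.all_eq_true] at hS
  obtain ⟨⟨htwo, w₀, hw₀, hw₀S⟩, hint⟩ := hS
  let PS : Fin π.1 → Prop := fun x =>
    (∃ a ∈ M, a.2 ∈ S ∧ a.1 ≤ x) ∧ ∃ b ∈ M, b.2 ∈ S ∧ x ≤ b.1
  let VS : Fin π.1 → Prop := fun x =>
    (∃ a ∈ M, a.2 ∈ S ∧ π.2 a.1 ≤ π.2 x) ∧ ∃ b ∈ M, b.2 ∈ S ∧ π.2 x ≤ π.2 b.1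
  have hmem : ∀ m ∈ M, m.2 ∉ S → ¬ PS m.1 ∧ ¬ VS m.1 := by
    intro m hm hmS
    obtain ⟨M₁, M₂, rfl⟩ := List.append_of_mem hm
    have hpw := h
    rw [Occurrence, List.pairwise_append, List.pairwise_cons] at hpw
    have := hint M₁.length (List.mem_range.2 (by simp))
    simp only [List.map_append, List.map_cons] at this
    rw [List.drop_left' (by simp), List.take_left' (by simp)] at this
    simp only [Bool.or_eq_true, List.contains_iff_mem, hmS, false_or, Bool.and_eq_true,
      Bool.not_eq_true', ← Bool.not_eq_true, splitsPositions_iff, splitsValues_iff] at this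
    refine ⟨fun hP => this.1 ?_, fun hV => this.2 ?_⟩
    · obtain ⟨⟨a, ha, haS, hax⟩, ⟨b, hb, hbS, hbx⟩⟩ := hP
      refine ⟨⟨a.2, List.mem_map_of_mem ?_, haS⟩, ⟨b.2, ?_, hbS⟩⟩
      · rcases List.mem_append.1 ha with ha | ha
        · exact ha
        · rcases List.mem_cons.1 ha with rfl | ha
          · exact absurd haS hmS
          · exact absurd hax (hpw.2.1.1 a ha).1.not_ge
      · rw [← List.map_cons]
        refine List.mem_map_of_mem ?_
        rcases List.mem_append.1 hb with hb | hb
        · exact absurd hbx (hpw.2.2 b hb m List.mem_cons_self).1.not_ge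
        · exact hb
    · obtain ⟨⟨a, ha, haS, hax⟩, ⟨b, hb, hbS, hbx⟩⟩ := hV
      rw [← List.map_cons, ← List.map_append]
      refine ⟨⟨a.2, List.mem_map_of_mem ha, haS, ?_⟩, ⟨b.2, List.mem_map_of_mem hb, hbS, ?_⟩⟩
      · have h1 : ¬ m.2 < a.2 := fun hlt => ((h.label_lt_iff hm ha).1 hlt).not_ge hax
        have h2 : a.2 ≠ m.2 := fun e => hmS (e ▸ haS)
        omega
      · have h1 : ¬ b.2 < m.2 := fun hlt => ((h.label_lt_iff hb hm).1 hlt).not_ge hbx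
        omega
  obtain ⟨x, hx⟩ : ∃ x, ¬ (PS x ↔ VS x) := by
    by_contra! hall
    have hI : IsInterval π {x | PS x} := by
      constructor
      · refine ⟨fun y hy z hz u hu => ⟨?_, ?_⟩⟩
        · obtain ⟨a, ha, haS, hay⟩ := hy.1
          exact ⟨a, ha, haS, hay.trans hu.1⟩
        · obtain ⟨b, hb, hbS, hbz⟩ := hz.2
          exact ⟨b, hb, hbS, hu.2.trans hbz⟩
      · refine ⟨?_⟩
        rintro _ ⟨y, hy, rfl⟩ _ ⟨z, hz, rfl⟩ u hu
        refine ⟨π.2.symm u, (hall _).2 ⟨?_, ?_⟩, π.2.apply_symm_apply u⟩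
        · obtain ⟨a, ha, haS, hay⟩ := ((hall y).1 hy).1
          exact ⟨a, ha, haS, by rw [π.2.apply_symm_apply]; exact hay.trans hu.1⟩
        · obtain ⟨b, hb, hbS, hbz⟩ := ((hall z).1 hz).2
          exact ⟨b, hb, hbS, by rw [π.2.apply_symm_apply]; exact hu.2.trans hbz⟩
    have hself : ∀ a ∈ M, a.2 ∈ S → PS a.1 := fun a ha haS =>
      ⟨⟨a, ha, haS, le_rfl⟩, ⟨a, ha, haS, le_rfl⟩⟩
    rcases hπ _ hI with hsub | huniv
    · have hlen : 2 ≤ (M.filter fun a => S.contains a.2).length := by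
        have := Nat.le_of_ble_eq_true htwo
        rwa [List.countP_map, List.countP_eq_length_filter] at this
      have hocc := h.sublist (M' := M.filter fun a => S.contains a.2) List.filter_sublist
      have hfil : ∀ a ∈ M.filter fun a => S.contains a.2, PS a.1 := by
        intro a ha
        rw [List.mem_filter, List.contains_iff_mem] at ha
        exact hself a ha.1 ha.2
      match hF : M.filter fun a => S.contains a.2 with
      | [] => rw [hF] at hlen; simp at hlen
      | [a] => rw [hF] at hlen; simp at hlen
      | a :: b :: F =>
        rw [hF] at hocc hfil
        exact (List.rel_of_pairwise_cons hocc List.mem_cons_self).1.ne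
          (hsub (hfil a (by simp)) (hfil b (by simp)))
    · obtain ⟨m, hm, rfl⟩ := List.mem_map.1 hw₀
      have hmS : m.2 ∉ S := by simpa using hw₀S
      exact (hmem m hm hmS).1 (huniv.symm ▸ Set.mem_univ m.1 : m.1 ∈ {x | PS x})
  -- Entries of the block lie in both hulls and the other entries of `M` in neither, so `x` is new.
  have hxM : ∀ a ∈ M, a.1 ≠ x := by
    rintro a ha rfl
    by_cases haS : a.2 ∈ S
    · exact hx ⟨fun _ => ⟨⟨a, ha, haS, le_rfl⟩, ⟨a, ha, haS, le_rfl⟩⟩,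
        fun _ => ⟨⟨a, ha, haS, le_rfl⟩, ⟨a, ha, haS, le_rfl⟩⟩⟩
    · exact hx (iff_of_false (hmem a ha haS).1 (hmem a ha haS).2)
  obtain ⟨M₁, M₂, v, rfl, h1, h2, hv, hvx, M', hM', hlab⟩ := h.exists_insert hxM
  have ht : (((M₁ ++ M₂).map Prod.snd).take M₁.length) = M₁.map Prod.snd := by
    rw [List.map_append, List.take_left' (by simp)]
  have hd : (((M₁ ++ M₂).map Prod.snd).drop M₁.length) = M₂.map Prod.snd := by
    rw [List.map_append, List.drop_left' (by simp)]
  refine ⟨M₁.length, List.mem_range.2 (by simp), v, hv, ?_, M', hM', ?_⟩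
  · rw [ht, hd]
    have hP : splitsPositions S (M₁.map Prod.snd) (M₂.map Prod.snd) = true ↔ PS x := by
      rw [splitsPositions_iff]
      constructor
      · rintro ⟨⟨w, hw, hwS⟩, ⟨z, hz, hzS⟩⟩
        obtain ⟨a, ha, rfl⟩ := List.mem_map.1 hw
        obtain ⟨b, hb, rfl⟩ := List.mem_map.1 hz
        exact ⟨⟨a, List.mem_append_left _ ha, hwS, (h1 a ha).le⟩,
          ⟨b, List.mem_append_right _ hb, hzS, (h2 b hb).le⟩⟩
      · rintro ⟨⟨a, ha, haS, hax⟩, ⟨b, hb, hbS, hbx⟩⟩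
        refine ⟨⟨a.2, List.mem_map_of_mem ?_, haS⟩, ⟨b.2, List.mem_map_of_mem ?_, hbS⟩⟩
        · exact (List.mem_append.1 ha).resolve_right fun h' => (h2 a h').not_ge hax
        · exact (List.mem_append.1 hb).resolve_left fun h' => (h1 b h').not_ge hbx
    have hV : splitsValues S ((M₁ ++ M₂).map Prod.snd) v = true ↔ VS x := by
      rw [splitsValues_iff]
      constructor
      · rintro ⟨⟨w, hw, hwS, hwv⟩, ⟨z, hz, hzS, hzv⟩⟩
        obtain ⟨a, ha, rfl⟩ := List.mem_map.1 hw
        obtain ⟨b, hb, rfl⟩ := List.mem_map.1 hz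
        exact ⟨⟨a, ha, hwS, ((hvx a ha).1 hwv).le⟩,
          ⟨b, hb, hzS, not_lt.1 fun h' => ((hvx b hb).2 h').not_ge hzv⟩⟩
      · rintro ⟨⟨a, ha, haS, hax⟩, ⟨b, hb, hbS, hbx⟩⟩
        refine ⟨⟨a.2, List.mem_map_of_mem ha, haS, (hvx a ha).2 (lt_of_le_of_ne hax ?_)⟩,
          ⟨b.2, List.mem_map_of_mem hb, hbS, not_lt.1 fun h' => ((hvx b hb).1 h').not_ge hbx⟩⟩
        exact fun e => hxM a ha (π.2.injective e)
    rw [← hP, ← hV] at hx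
    revert hx
    cases splitsPositions S (M₁.map Prod.snd) (M₂.map Prod.snd) <;>
      cases splitsValues S ((M₁ ++ M₂).map Prod.snd) v <;> simp
  · rw [ht, hd, hlab]

theorem Occurrence.of_hasExceptional {π : FinPerm} {M : List (Fin π.1 × ℕ)} (h : Occurrence π M)
    (hM : hasExceptional (M.map Prod.snd) = true) :
    Contained perm25314 π ∨ Contained perm41352 π := by
  have key : ∀ ρ : FinPerm, ∀ s : List ℕ, s.Sublist (M.map Prod.snd) →
      PermClass.standardize s = oneLine ρ → Contained ρ π := by
    intro ρ s hs hρ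
    obtain ⟨⟨n, q⟩, h1, h2⟩ := h.exists_standardize hs
    obtain ⟨m, p⟩ := ρ
    rw [hρ] at h1
    obtain rfl : n = m := by
      have := congrArg List.length h1
      rwa [length_oneLine, length_oneLine] at this
    obtain rfl := oneLine_injective n h1
    exact h2
  rw [hasExceptional, List.any_eq_true] at hM
  obtain ⟨s, hs, hsM⟩ := hM
  rw [Bool.and_eq_true, Bool.or_eq_true, beq_iff_eq, beq_iff_eq] at hsM
  rw [List.mem_sublists] at hs
  rcases hsM.2 with he | he
  · exact Or.inl (key perm25314 s hs (he.trans rfl))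
  · exact Or.inr (key perm41352 s hs (he.trans rfl))

/-! ### Simple permutations containing 321 -/

/-- Each cut lengthens the occurrence, whose length is bounded by that of `π`; the induction is on
the difference. -/
theorem contained_exceptional_of_mem_blockTable {π : FinPerm} (hπ : IsSimple π)
    (hlow : LowGrowth π) {M : List (Fin π.1 × ℕ)} (h : Occurrence π M) {S : List ℕ}
    (hM : (M.map Prod.snd, S) ∈ blockTable) :
    Contained perm25314 π ∨ Contained perm41352 π := by
  induction hk : π.1 - M.length using Nat.strong_induction_on generalizing M S with
  | _ k ih =>
    have hsplit := List.all_eq_true.1 blockTable_splits _ hM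
    rw [splitsIntoTable, Bool.and_eq_true] at hsplit
    obtain ⟨t, ht, v, hv, hcut, M', hM', hlab⟩ := h.exists_splitting hπ hsplit.1
    have := List.all_eq_true.1 (List.all_eq_true.1 hsplit.2 t ht) v hv
    rw [hcut, Bool.not_true, Bool.false_or, ← hlab, hlow M' hM', Bool.or_false,
      Bool.or_eq_true, List.any_eq_true] at this
    rcases this with ⟨⟨l, S'⟩, hl, hle⟩ | hex
    · rw [beq_iff_eq] at hle
      subst hle
      refine ih _ ?_ hM' hl rfl
      have h1 := hM'.length_le
      have h2 := congrArg List.length hlab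
      simp only [List.length_map, insertLetter, List.length_append, List.length_cons,
        List.length_take, List.length_drop] at h2
      omega
    · exact hM'.of_hasExceptional hex

theorem contained_exceptional_of_contained_321 {π : FinPerm} (hπ : IsSimple π)
    (hlow : LowGrowth π) (h : Contained perm321 π) :
    Contained perm25314 π ∨ Contained perm41352 π := by
  obtain ⟨f, hf, hfπ⟩ := h
  obtain ⟨h1, h2⟩ := Contained.exists_occurrence hf hfπ
  refine contained_exceptional_of_mem_blockTable hπ hlow h1 (S := [2, 1]) ?_
  rw [h2]
  exact List.mem_cons_self

/-! ### Rigidity of 25314 and 41352 -/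

/-- Every further entry of `π` lies below and to the left, or above and to the right, of an
occurrence of a rigid pattern. -/
theorem LowGrowth.corner_of_isRigid {σ π : FinPerm} (hlow : LowGrowth π)
    (hσ : isRigid (oneLine σ) = true) {f : Fin σ.1 → Fin π.1} (hf : StrictMono f)
    (hfπ : ∀ i j, σ.2 i < σ.2 j ↔ π.2 (f i) < π.2 (f j)) {x : Fin π.1} (hx : ∀ i, f i ≠ x) :
    (∀ i, x < f i ∧ π.2 x < π.2 (f i)) ∨ ∀ i, f i < x ∧ π.2 (f i) < π.2 x := by
  obtain ⟨hocc, hlab⟩ := Contained.exists_occurrence hf hfπ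
  set M := List.ofFn fun i => (f i, (σ.2 i : ℕ)) with hMdef
  have hmemM : ∀ i, (f i, (σ.2 i : ℕ)) ∈ M := fun i => List.mem_ofFn.2 ⟨i, rfl⟩
  have hxM : ∀ a ∈ M, a.1 ≠ x := by
    intro a ha
    obtain ⟨i, rfl⟩ := List.mem_ofFn.1 ha
    exact hx i
  obtain ⟨M₁, M₂, v, hM, h1, h2, hv, hvx, M', hM', hlab'⟩ := hocc.exists_insert hxM
  have hl : oneLine σ = M₁.map Prod.snd ++ M₂.map Prod.snd := by
    rw [← hlab, hM, List.map_append]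
  have ht : (oneLine σ).take M₁.length = M₁.map Prod.snd := by
    rw [hl, List.take_left' (by simp)]
  have hd : (oneLine σ).drop M₁.length = M₂.map Prod.snd := by
    rw [hl, List.drop_left' (by simp)]
  have hlen : (oneLine σ).length = M₁.length + M₂.length := by rw [hl]; simp
  rw [hlab] at hv
  have := List.all_eq_true.1 (List.all_eq_true.1 hσ M₁.length
    (List.mem_range.2 (by omega))) v hv
  rw [ht, hd, ← hlab', hlow M' hM', Bool.or_false, Bool.or_eq_true, Bool.and_eq_true,
    Bool.and_eq_true] at this
  have hlt : ∀ i, π.2 (f i) < π.2 x ↔ (σ.2 i : ℕ) < v := fun i => (hvx _ (hmemM i)).symm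
  rcases this with ⟨e1, e2⟩ | ⟨e1, e2⟩
  · left
    intro i
    have e1' := Nat.eq_of_beq_eq_true e1
    have e2' := Nat.eq_of_beq_eq_true e2
    have hi := hmemM i
    -- No entry of the occurrence precedes `x`, and no label is below `v = 0`.
    rw [hM, List.length_eq_zero_iff.1 e1', List.nil_append] at hi
    refine ⟨h2 _ hi, lt_of_le_of_ne (not_lt.1 fun h' => ?_) fun e => hx i (π.2.injective e).symm⟩
    rw [hlt, e2'] at h'
    exact Nat.not_lt_zero _ h'
  · right
    intro i
    have e1' := Nat.eq_of_beq_eq_true e1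
    have e2' := Nat.eq_of_beq_eq_true e2
    have hi := hmemM i
    rw [hM, List.length_eq_zero_iff.1 (by omega : M₂.length = 0), List.append_nil] at hi
    refine ⟨h1 _ hi, (hlt i).2 ?_⟩
    rw [e2', length_oneLine]
    exact (σ.2 i).2

/-- A strictly increasing map of a finite chain onto itself is the identity. This applies to `f` and
then to `q ∘ p⁻¹`. -/
theorem eq_of_surjective_of_contained {σ π : FinPerm} {f : Fin σ.1 → Fin π.1} (hf : StrictMono f)
    (hfπ : ∀ i j, σ.2 i < σ.2 j ↔ π.2 (f i) < π.2 (f j)) (hsurj : Function.Surjective f) :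
    σ = π := by
  obtain ⟨n, p⟩ := σ
  obtain ⟨m, q⟩ := π
  obtain rfl : n = m := by
    simpa using Fintype.card_congr (Equiv.ofBijective f ⟨hf.injective, hsurj⟩)
  obtain rfl : f = id := (hf.range_inj strictMono_id).1 (by rw [hsurj.range_eq, Set.range_id])
  have hmono : StrictMono fun i => q (p.symm i) := by
    intro i j hij
    have := hfπ (p.symm i) (p.symm j)
    simp only [Equiv.apply_symm_apply, id] at this
    exact this.1 hij
  have hid : (fun i => q (p.symm i)) = id := by
    refine (hmono.range_inj strictMono_id).1 ?_
    rw [Set.range_id]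
    exact (q.surjective.comp p.symm.surjective).range_eq
  have : p = q := by
    ext i
    have := congrFun hid (p i)
    simp only [Equiv.symm_apply_apply, id] at this
    rw [this]
  rw [this]

/-- Since all other entries lie in the two corners, none falls between entries of the occurrence in
position or in value. Its range is thus an interval, and `2 ≤ σ.1` leaves only the whole of `π`. -/
theorem LowGrowth.eq_of_isRigid {σ π : FinPerm} (hlow : LowGrowth π) (hπ : IsSimple π)
    (hσ : isRigid (oneLine σ) = true) (h2 : 2 ≤ σ.1) (h : Contained σ π) : π = σ := by
  obtain ⟨f, hf, hfπ⟩ := h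
  have hcorner : ∀ u, u ∉ Set.range f →
      (∀ i, u < f i ∧ π.2 u < π.2 (f i)) ∨ ∀ i, f i < u ∧ π.2 (f i) < π.2 u := fun u hu =>
    hlow.corner_of_isRigid hσ hf hfπ fun i hi => hu ⟨i, hi⟩
  have hI : IsInterval π (Set.range f) := by
    constructor
    · refine ⟨?_⟩
      rintro _ ⟨i, rfl⟩ _ ⟨j, rfl⟩ u hu
      by_contra hur
      rcases hcorner u hur with h | h
      · exact (h i).1.not_ge hu.1
      · exact (h j).1.not_ge hu.2
    · refine ⟨?_⟩
      rintro _ ⟨_, ⟨i, rfl⟩, rfl⟩ _ ⟨_, ⟨j, rfl⟩, rfl⟩ u hu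
      obtain ⟨u, rfl⟩ := π.2.surjective u
      refine ⟨u, ?_, rfl⟩
      by_contra hur
      rcases hcorner u hur with h | h
      · exact (h i).2.not_ge hu.1
      · exact (h j).2.not_ge hu.2
  rcases hπ _ hI with hsub | huniv
  · have h01 : (⟨0, by omega⟩ : Fin σ.1) < ⟨1, by omega⟩ := by simp
    exact absurd (hsub ⟨_, rfl⟩ ⟨_, rfl⟩) (hf h01).ne
  · exact (eq_of_surjective_of_contained hf hfπ (Set.range_eq_univ.1 huniv)).symm

theorem LowGrowth.simple_cases {π : FinPerm} (hlow : LowGrowth π) (hπ : IsSimple π) :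
    ¬ Contained perm321 π ∨ π = perm25314 ∨ π = perm41352 := by
  by_cases h : Contained perm321 π
  · right
    rcases contained_exceptional_of_contained_321 hπ hlow h with h | h
    · exact Or.inl (hlow.eq_of_isRigid hπ isRigid_25314 (by decide) h)
    · exact Or.inr (hlow.eq_of_isRigid hπ isRigid_41352 (by decide) h)
  · exact Or.inl h

/-- The first entries of the blocks form a copy of `σ`. A second entry of block `i` compares with
the other blocks as `i` does in `σ`, so placing it in a corner would make `i` a corner of `σ`; `h1`
and `h2` exclude this. -/
theorem LowGrowth.not_isProperInflation {σ π : FinPerm} (hlow : LowGrowth π)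
    (hσ : isRigid (oneLine σ) = true)
    (h1 : ∀ i, ∃ j, i ≠ j ∧ ¬ (i < j ∧ σ.2 i < σ.2 j))
    (h2 : ∀ i, ∃ j, i ≠ j ∧ ¬ (j < i ∧ σ.2 j < σ.2 i)) : ¬ IsProperInflation π σ := by
  rintro ⟨α, hα, ⟨i, hi⟩, e, he1, he2, he3, he4⟩
  let z : ∀ j, Fin (α j).1 := fun j => ⟨0, hα j⟩
  let f : Fin σ.1 → Fin π.1 := fun j => e ⟨j, z j⟩
  have hf : StrictMono f := fun j k hjk => (he1 j k _ _ hjk.ne).2 hjk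
  have hfπ : ∀ j k, σ.2 j < σ.2 k ↔ π.2 (f j) < π.2 (f k) := by
    intro j k
    by_cases hjk : j = k
    · subst hjk; simp
    · exact (he3 j k _ _ hjk).symm
  have hx : ∀ j, f j ≠ e ⟨i, ⟨1, hi⟩⟩ := by
    intro j hj
    have h := e.injective hj
    obtain rfl : j = i := congrArg Sigma.fst h
    have := eq_of_heq (Sigma.mk.inj h).2
    simp [z] at this
  rcases hlow.corner_of_isRigid hσ hf hfπ hx with h | h
  · obtain ⟨j, hij, hj⟩ := h1 i
    exact hj ⟨(he1 _ _ _ _ hij).1 (h j).1, (he3 _ _ _ _ hij).1 (h j).2⟩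
  · obtain ⟨j, hij, hj⟩ := h2 i
    exact hj ⟨(he1 _ _ _ _ hij.symm).1 (h j).1, (he3 _ _ _ _ hij.symm).1 (h j).2⟩

theorem LowGrowth.not_isProperInflation_exceptional {π : FinPerm} (hlow : LowGrowth π) :
    ¬ IsProperInflation π perm25314 ∧ ¬ IsProperInflation π perm41352 :=
  ⟨hlow.not_isProperInflation isRigid_25314 (by decide) (by decide),
    hlow.not_isProperInflation isRigid_41352 (by decide) (by decide)⟩

/-! ### Decomposing non-simple permutations -/

/-- The pattern of `π` on the set `B` of positions. -/
noncomputable def restrict (π : FinPerm) (B : Finset (Fin π.1)) : FinPerm :=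
  ⟨B.card, (B.orderIsoOfFin rfl).toEquiv.trans
    ((π.2.subtypeEquiv (p := fun x => x ∈ B) (q := fun x => x ∈ B.map π.2.toEmbedding)
      fun x => by simp).trans
        ((B.map π.2.toEmbedding).orderIsoOfFin (Finset.card_map _)).symm.toEquiv)⟩

theorem restrict_lt_iff (π : FinPerm) (B : Finset (Fin π.1)) (i j : Fin B.card) :
    (restrict π B).2 i < (restrict π B).2 j ↔
      π.2 (B.orderEmbOfFin rfl i) < π.2 (B.orderEmbOfFin rfl j) :=
  ((B.map π.2.toEmbedding).orderIsoOfFin (Finset.card_map _)).symm.lt_iff_lt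

theorem contained_restrict (π : FinPerm) (B : Finset (Fin π.1)) : Contained (restrict π B) π :=
  ⟨B.orderEmbOfFin rfl, (B.orderEmbOfFin rfl).strictMono, restrict_lt_iff π B⟩

theorem exists_orderEmbOfFin_eq {n : ℕ} {B : Finset (Fin n)} {x : Fin n} (hx : x ∈ B) :
    ∃ i, B.orderEmbOfFin rfl i = x := by
  have : x ∈ Set.range (B.orderEmbOfFin rfl) := by rwa [Finset.range_orderEmbOfFin]
  exact this

theorem lt_iff_lt_of_ordConnected {β : Type*} [LinearOrder β] {I : Set β} (hI : I.OrdConnected)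
    {x x' y : β} (hx : x ∈ I) (hx' : x' ∈ I) (hy : y ∉ I) : (x < y ↔ x' < y) ∧ (y < x ↔ y < x') := by
  have key : ∀ {u v}, u ∈ I → v ∈ I → u < y → v < y := fun {u v} hu hv huy => by
    by_contra hle
    exact hy (hI.out hu hv ⟨huy.le, not_lt.1 hle⟩)
  have key' : ∀ {u v}, u ∈ I → v ∈ I → y < u → y < v := fun {u v} hu hv huy => by
    by_contra hle
    exact hy (hI.out hv hu ⟨not_lt.1 hle, huy.le⟩)
  exact ⟨⟨key hx hx', key hx' hx⟩, ⟨key' hx hx', key' hx' hx⟩⟩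

/-- A nontrivial interval `I` is contracted to its entry `x₀`: `T` keeps `x₀` and the complement of
`I`. The block of `x₀` is all of `I`, and every other block is a single entry. -/
theorem exists_inflation_of_not_isSimple {π : FinPerm} (h : ¬ IsSimple π) :
    ∃ (σ : FinPerm) (α : Fin σ.1 → FinPerm), IsInflation π σ α ∧ Contained σ π ∧ σ.1 < π.1 ∧
      ∀ i, Contained (α i) π ∧ 1 ≤ (α i).1 ∧ (α i).1 < π.1 := by
  classical
  simp only [IsSimple, not_forall, not_or, Set.not_subsingleton_iff] at h
  obtain ⟨I, hI, ⟨x₀, hx₀, x₁, hx₁, hne⟩, huniv⟩ := h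
  let S : Finset (Fin π.1) := Finset.univ.filter (· ∈ I)
  let T : Finset (Fin π.1) := Finset.univ.filter fun x => x ∈ I → x = x₀
  have hS : ∀ x, x ∈ S ↔ x ∈ I := fun x => by simp [S]
  have hT : ∀ x, x ∈ T ↔ (x ∈ I → x = x₀) := fun x => by simp [T]
  let f : Fin T.card ↪o Fin π.1 := T.orderEmbOfFin rfl
  have hfT : ∀ i, f i ∈ I → f i = x₀ := fun i => (hT _).1 (T.orderEmbOfFin_mem rfl i)
  let B : Fin T.card → Finset (Fin π.1) := fun i => if f i ∈ I then S else {f i}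
  have hBin : ∀ {i}, f i ∈ I → B i = S := fun {i} hi => if_pos hi
  have hBout : ∀ {i}, f i ∉ I → B i = {f i} := fun {i} hi => if_neg hi
  have hself : ∀ i, f i ∈ B i := by
    intro i
    by_cases hi : f i ∈ I
    · rw [hBin hi, hS]; exact hi
    · rw [hBout hi]; exact Finset.mem_singleton_self _
  -- An entry outside an interval compares in the same way with all entries of the interval, so each
  -- block may be represented by `f i`.
  have hpair : ∀ i j x y, i ≠ j → x ∈ B i → y ∈ B j →
      (x < y ↔ f i < f j) ∧ (π.2 x < π.2 y ↔ π.2 (f i) < π.2 (f j)) := by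
    intro i j x y hij hx hy
    have himg : ∀ {u}, π.2 u ∈ π.2 '' I ↔ u ∈ I := fun {u} => π.2.injective.mem_set_image
    by_cases hi : f i ∈ I <;> by_cases hj : f j ∈ I
    · exact absurd (f.injective ((hfT i hi).trans (hfT j hj).symm)) hij
    · rw [hBin hi, hS] at hx
      rw [hBout hj, Finset.mem_singleton] at hy
      subst hy
      exact ⟨(lt_iff_lt_of_ordConnected hI.1 hx hi hj).1,
        (lt_iff_lt_of_ordConnected hI.2 (himg.2 hx) (himg.2 hi) (fun h => hj (himg.1 h))).1⟩
    · rw [hBin hj, hS] at hy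
      rw [hBout hi, Finset.mem_singleton] at hx
      subst hx
      exact ⟨(lt_iff_lt_of_ordConnected hI.1 hy hj hi).2,
        (lt_iff_lt_of_ordConnected hI.2 (himg.2 hy) (himg.2 hj) (fun h => hi (himg.1 h))).2⟩
    · rw [hBout hj, Finset.mem_singleton] at hy
      rw [hBout hi, Finset.mem_singleton] at hx
      subst hx hy
      exact ⟨Iff.rfl, Iff.rfl⟩
  refine ⟨restrict π T, fun i => restrict π (B i), ?_, contained_restrict π T, ?_, fun i =>
    ⟨contained_restrict π _, Finset.card_pos.2 ⟨_, hself i⟩, ?_⟩⟩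
  · refine isInflation_of_blocks (σ := restrict π T) (α := fun i => restrict π (B i))
      (fun i a => (B i).orderEmbOfFin rfl a) ?_ ?_ ?_ ?_ ?_
    · intro x
      by_cases hx : x ∈ I
      · obtain ⟨i, hi⟩ := exists_orderEmbOfFin_eq ((hT x₀).2 fun _ => rfl)
        have hxB : x ∈ B i := by
          rw [hBin (show f i ∈ I from hi.symm ▸ hx₀), hS]; exact hx
        obtain ⟨a, ha⟩ := exists_orderEmbOfFin_eq hxB
        exact ⟨i, a, ha⟩
      · obtain ⟨i, hi⟩ := exists_orderEmbOfFin_eq ((hT x).2 fun h => absurd h hx)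
        have hxB : x ∈ B i := by
          have := hself i
          rwa [show f i = x from hi] at this
        obtain ⟨a, ha⟩ := exists_orderEmbOfFin_eq hxB
        exact ⟨i, a, ha⟩
    · intro i j a b hij
      exact (hpair i j _ _ hij ((B i).orderEmbOfFin_mem rfl a)
        ((B j).orderEmbOfFin_mem rfl b)).1.trans f.lt_iff_lt
    · intro i a b
      exact ((B i).orderEmbOfFin rfl).lt_iff_lt
    · intro i j a b hij
      exact (hpair i j _ _ hij ((B i).orderEmbOfFin_mem rfl a)
        ((B j).orderEmbOfFin_mem rfl b)).2.trans (restrict_lt_iff π T i j).symm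
    · intro i a b
      exact (restrict_lt_iff π (B i) a b).symm
  · have : x₁ ∉ T := fun h => hne ((hT x₁).1 h hx₁).symm
    show T.card < π.1
    simpa using Finset.card_lt_univ_of_notMem this
  · show (B i).card < π.1
    by_cases hi : f i ∈ I
    · obtain ⟨y, hy⟩ := (Set.ne_univ_iff_exists_notMem I).1 huniv
      rw [hBin hi]
      simpa using Finset.card_lt_univ_of_notMem (fun h => hy ((hS y).1 h))
    · rw [hBout hi, Finset.card_singleton]
      simpa using Fintype.one_lt_card_iff.2 ⟨x₀, x₁, hne⟩

/-- Strong induction on the length: the outer permutation and the blocks of the decomposition are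
shorter and inherit `Q`. -/
theorem mem_substitutionClosure_of_simple {C : Set FinPerm} {Q : FinPerm → Prop}
    (hQ : ∀ σ π, Contained σ π → Q π → Q σ) (hC : ∀ π, Q π → IsSimple π → π ∈ C) {π : FinPerm}
    (hπ : Q π) : π ∈ substitutionClosure C := by
  intro D hD
  induction hn : π.1 using Nat.strong_induction_on generalizing π with
  | _ n ih =>
    by_cases hs : IsSimple π
    · exact hD.2.2 (hC π hπ hs)
    · obtain ⟨σ, α, hinf, hσ, hlt, hα⟩ := exists_inflation_of_not_isSimple hs
      exact hD.2.1 σ (ih _ (hn ▸ hlt) (hQ _ _ hσ hπ) rfl) α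
        (fun i => ⟨ih _ (hn ▸ (hα i).2.2) (hQ _ _ (hα i).1 hπ) rfl, (hα i).2.1⟩) π hinf

/-! ### Transfer to the skew case and conclusion -/

theorem IsSimple.reverse {π : FinPerm} (h : IsSimple π) : IsSimple (reverse π) := by
  intro I hI
  have himg : π.2 '' (Fin.rev ⁻¹' I) = (PermClass.reverse π).2 '' I := by
    ext y
    constructor
    · rintro ⟨x, hx, rfl⟩
      exact ⟨x.rev, hx, by rw [reverse_apply, Fin.rev_rev]⟩
    · rintro ⟨x, hx, rfl⟩
      exact ⟨x.rev, by rwa [Set.mem_preimage, Fin.rev_rev], rfl⟩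
  have hint : IsInterval π (Fin.rev ⁻¹' I) := by
    refine ⟨⟨fun x hx y hy z hz => ?_⟩, himg ▸ hI.2⟩
    exact hI.1.out hy hx ⟨Fin.rev_le_rev.2 hz.2, Fin.rev_le_rev.2 hz.1⟩
  rcases h _ hint with hs | hu
  · left
    intro x hx y hy
    refine Fin.rev_injective (hs ?_ ?_)
    · rwa [Set.mem_preimage, Fin.rev_rev]
    · rwa [Set.mem_preimage, Fin.rev_rev]
  · right
    refine Set.eq_univ_of_forall fun x => ?_
    have : x.rev ∈ Fin.rev ⁻¹' I := hu ▸ Set.mem_univ _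
    rwa [Set.mem_preimage, Fin.rev_rev] at this

theorem reverse_perm123 : reverse perm123 = perm321 :=
  Sigma.ext rfl (heq_of_eq (Equiv.ext (by decide)))

theorem reverse_perm25314 : reverse perm25314 = perm41352 :=
  Sigma.ext rfl (heq_of_eq (Equiv.ext (by decide)))

theorem reverse_perm41352 : reverse perm41352 = perm25314 :=
  Sigma.ext rfl (heq_of_eq (Equiv.ext (by decide)))

theorem IsProperInflation.reverse {τ σ : FinPerm} (h : IsProperInflation τ σ) :
    IsProperInflation (reverse τ) (reverse σ) := by
  obtain ⟨α, h1, ⟨i, hi⟩, h⟩ := h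
  refine ⟨fun i => PermClass.reverse (α i.rev), fun i => h1 _, ⟨i.rev, ?_⟩,
    h.reverse _ fun _ => rfl⟩
  show 2 ≤ (α i.rev.rev).1
  rwa [Fin.rev_rev]

theorem LowGrowth.simple_mem {π : FinPerm} (hlow : LowGrowth π) (hπ : IsSimple π) :
    π ∈ Av {perm321} ∪ Av {perm123} ∪ {perm25314, perm41352} := by
  rcases hlow.simple_cases hπ with h | h
  · exact Or.inl (Or.inl fun β hβ => hβ ▸ h)
  · exact Or.inr h

theorem simple_mem_of_lowGrowth_reverse {π : FinPerm} (hlow : LowGrowth (reverse π))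
    (hπ : IsSimple π) : π ∈ Av {perm321} ∪ Av {perm123} ∪ {perm25314, perm41352} := by
  rcases hlow.simple_cases hπ.reverse with h | h | h
  · refine Or.inl (Or.inr fun β hβ hc => h ?_)
    obtain rfl : β = perm123 := hβ
    rw [← reverse_perm123]
    exact hc.reverse
  · right; right
    show π = perm41352
    rw [← reverse_reverse π, h, reverse_perm25314]
  · right; left
    rw [← reverse_reverse π, h, reverse_perm41352]

end PermClass

theorem mainTheorem8 :
    (∀ π ∈ PermClass.cellClass 2.36, PermClass.IsSimple π →
      π ∈ PermClass.Av {PermClass.perm321} ∪ PermClass.Av {PermClass.perm123} ∪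
        {PermClass.perm25314, PermClass.perm41352}) ∧
    (∀ π ∈ PermClass.cellClass 2.36,
      ¬ PermClass.IsProperInflation π PermClass.perm25314 ∧
      ¬ PermClass.IsProperInflation π PermClass.perm41352) ∧
    PermClass.cellClass 2.36 ⊆
      PermClass.substitutionClosure
        (PermClass.Av {PermClass.perm321} ∪ PermClass.Av {PermClass.perm123} ∪
          {PermClass.perm25314, PermClass.perm41352}) := by
  refine ⟨fun π hπ hs => ?_, fun π hπ => ?_, fun π hπ => ?_⟩ <;>
    rcases PermClass.lowGrowth_or_of_mem_cellClass hπ with h | h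
  · exact h.simple_mem hs
  · exact PermClass.simple_mem_of_lowGrowth_reverse h hs
  · exact h.not_isProperInflation_exceptional
  · obtain ⟨h1, h2⟩ := h.not_isProperInflation_exceptional
    -- Reversal exchanges 25314 and 41352, so the two conclusions are swapped.
    exact ⟨fun hp => h2 (PermClass.reverse_perm25314 ▸ hp.reverse),
      fun hp => h1 (PermClass.reverse_perm41352 ▸ hp.reverse)⟩
  · exact PermClass.mem_substitutionClosure_of_simple (Q := PermClass.LowGrowth)
      (fun _ _ hc hl => hl.of_contained hc) (fun _ hl hs => hl.simple_mem hs) h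
  · exact PermClass.mem_substitutionClosure_of_simple
      (Q := fun π => PermClass.LowGrowth (PermClass.reverse π))
      (fun _ _ hc hl => hl.of_contained hc.reverse)
      (fun _ hl hs => PermClass.simple_mem_of_lowGrowth_reverse hl hs) h
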